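/- For $b>0$, call a finite graph $\mathcal G$ a $(b,d)$-expander if its maximum degree is $d$ and, for every set $S\subset V(\mathcal G)$ of at most $|V(\mathcal G)|/2$ vertices, there are at least $b|S|$ edges between $S$ and $V(\mathcal G)\setminus S$. Let $\mathcal G_p$ denote bond percolation on $\mathcal G$, i.e. the distribution of the random spanning subgraph of $\mathcal G$ in which each edge of $\mathcal G$ is present, independently, with probability $p$. Fix an integer $d\ge 3$ and a real number $p$ with $\frac1{d-1}<p<1$. For every $b>0$ there exist $\delta,c,R>0$ (depending only on $d,p,b$) such that, if $\mathcal G$ is a $d$-regular $(b,d)$-expander on $n$ vertices with girth exceeding $R$, then with probability at least $1-e^{-cn}$ the random graph $G\sim\mathcal G_p$ contains a simple path of length (number of edges) at least $\delta n$. -/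

import Mathlib

open MeasureTheory ProbabilityTheory

namespace SimpleGraph

/-- A finite graph `G` is a `(b, d)`-expander if its maximum degree is `d` and, for every set `S` of
at most half of the vertices, there are at least `b * |S|` edges between `S` and its complement.
(An element of `G.interedges S Sᶜ` is a pair `(x, y)` of adjacent vertices with `x ∈ S`, `y ∉ S`, so
that each edge of the cut is counted exactly once.) -/
def IsExpander {V : Type*} [Fintype V] [DecidableEq V] (G : SimpleGraph V) [DecidableRel G.Adj]
    (b : ℝ) (d : ℕ) : Prop :=
  G.maxDegree = d ∧
    ∀ S : Finset V, 2 * S.card ≤ Fintype.card V →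
      b * (S.card : ℝ) ≤ ((G.interedges S Sᶜ).card : ℝ)

/-- Bond percolation on `G`: the law of the random spanning subgraph of `G` in which each edge of
`G` is present, independently, with probability `p`. -/
noncomputable def bondPercolation {V : Type*} (G : SimpleGraph V) (p : unitInterval) :
    Measure (SimpleGraph V) :=
  (setBernoulli G.edgeSet p).map fromEdgeSet

/-- `H` contains a (simple) path with at least `L` edges. -/
def HasPathOfLengthAtLeast {V : Type*} (H : SimpleGraph V) (L : ℝ) : Prop :=
  ∃ (u v : V) (w : H.Walk u v), w.IsPath ∧ L ≤ (w.length : ℝ)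

end SimpleGraph

/-! The proof is by sprinkling. Write m = d - 2 and p₀ = 1/(d - 1), choose p₁ strictly between p₀
and p, and let q be such that the union of independent percolations F₁ at p₁ and F₂ at q is
percolation at p.

Small clusters. If the girth exceeds K, a cluster with j + 1 < K vertices is a tree, with j open
edges and m(j + 1) + 2 closed boundary edges, hence of probability p₁^j (1 - p₁)^(m(j+1)+2). Since
x(1 - x)^m is largest at p₀, this is at most ρ times the same probability at p₀, where ρ < 1 does
not depend on K. Summing over clusters, a vertex lies in a cluster of fewer than K vertices with
probability at most ρ (`bernProb_card_cluster_lt`), without any branching process. One edge changes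
the number of such vertices by at most 2K, so the number concentrates
(`bernProb_card_smallVerts_ge`): with ρ = 1 - 2ε, at least εn vertices lie in big clusters of F₁,
outside an event of exponentially small probability.

No long path. Depth first search (`exists_separation`) turns the absence of a path of length of
order δn into a set U of at most δn vertices whose removal separates the vertices in big clusters
into two substantial parts. Deleting the edges at U destroys few big clusters, and the remaining
ones are divided into two families, each covering at least εn/4 vertices, which F₂ does not join
outside U (`exists_not_joins`).

Joining. By expansion, two sets of linear size are joined by linearly many disjoint edge sets of
bounded size, even after a few edges are deleted, so F₂ fails to join them with probability at most
about e^(-c₂n) (`bernProb_not_joins_le`).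

Union bound. There are at most n/K big clusters, hence at most 2^(n/K) divisions, and few choices of
U if δ is small. As c₂ depends on ε but not on K, one can take K large and then δ small, so that
e^(-c₂n) wins. -/

/-- Expectation of `f` evaluated at a random subset of `E` which contains each element of `E`
independently with probability `p`. -/
noncomputable def bernExp {α : Type*} [DecidableEq α] (p : ℝ) (E : Finset α)
    (f : Finset α → ℝ) : ℝ :=
  ∑ S ∈ E.powerset, p ^ S.card * (1 - p) ^ (E \ S).card * f S

open Classical in
/-- Probability of `Q` for a random subset of `E` which contains each element of `E`
independently with probability `p`. -/
noncomputable def bernProb {α : Type*} [DecidableEq α] (p : ℝ) (E : Finset α)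
    (Q : Finset α → Prop) : ℝ :=
  bernExp p E (fun S => if Q S then 1 else 0)

/-! ### Finite Bernoulli product measures -/

section Bernoulli

variable {α : Type*} [DecidableEq α] {p q : ℝ} {E : Finset α}

lemma bernExp_congr {f g : Finset α → ℝ} (h : ∀ S ⊆ E, f S = g S) :
    bernExp p E f = bernExp p E g :=
  Finset.sum_congr rfl fun S hS => by rw [h S (Finset.mem_powerset.1 hS)]

lemma bernExp_empty (f : Finset α → ℝ) : bernExp p ∅ f = f ∅ := by simp [bernExp]

lemma bernExp_insert {a : α} (ha : a ∉ E) (f : Finset α → ℝ) :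
    bernExp p (insert a E) f =
      p * bernExp p E (fun S => f (insert a S)) + (1 - p) * bernExp p E f := by
  unfold bernExp
  rw [Finset.sum_powerset_insert ha, Finset.mul_sum, Finset.mul_sum, add_comm]
  congr 1
  · refine Finset.sum_congr rfl fun S hS => ?_
    have hS' : a ∉ S := fun h => ha (Finset.mem_powerset.1 hS h)
    rw [Finset.card_insert_of_notMem hS', Finset.insert_sdiff_insert,
      Finset.sdiff_insert_of_notMem ha, pow_succ]
    ring
  · refine Finset.sum_congr rfl fun S hS => ?_
    have hS' : a ∉ S := fun h => ha (Finset.mem_powerset.1 hS h)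
    rw [Finset.insert_sdiff_of_notMem _ hS', Finset.card_insert_of_notMem (by simp [ha]), pow_succ]
    ring

lemma bernExp_add (f g : Finset α → ℝ) :
    bernExp p E (fun S => f S + g S) = bernExp p E f + bernExp p E g := by
  simp [bernExp, mul_add, Finset.sum_add_distrib]

lemma bernExp_const_mul (c : ℝ) (f : Finset α → ℝ) :
    bernExp p E (fun S => c * f S) = c * bernExp p E f := by
  simp only [bernExp, Finset.mul_sum]
  exact Finset.sum_congr rfl fun S _ => by ring

lemma bernExp_sum {ι : Type*} (s : Finset ι) (f : ι → Finset α → ℝ) :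
    bernExp p E (fun S => ∑ i ∈ s, f i S) = ∑ i ∈ s, bernExp p E (f i) := by
  simp only [bernExp, Finset.mul_sum]
  exact Finset.sum_comm

lemma bernExp_one : bernExp p E (fun _ => 1) = 1 := by
  induction E using Finset.induction_on with
  | empty => exact bernExp_empty _
  | insert a E ha ih => rw [bernExp_insert ha, ih]; ring

lemma bernExp_const (c : ℝ) : bernExp p E (fun _ => c) = c := by
  simpa [bernExp_one] using bernExp_const_mul (p := p) (E := E) c (fun _ => 1)

lemma bernExp_mono (hp0 : 0 ≤ p) (hp1 : p ≤ 1) {f g : Finset α → ℝ}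
    (h : ∀ S ⊆ E, f S ≤ g S) : bernExp p E f ≤ bernExp p E g :=
  Finset.sum_le_sum fun S hS => mul_le_mul_of_nonneg_left (h S (Finset.mem_powerset.1 hS))
    (mul_nonneg (pow_nonneg hp0 _) (pow_nonneg (by linarith) _))

lemma bernExp_union {E₁ E₂ : Finset α} (h : Disjoint E₁ E₂) (f : Finset α → ℝ) :
    bernExp p (E₁ ∪ E₂) f = bernExp p E₁ (fun S => bernExp p E₂ (fun T => f (S ∪ T))) := by
  induction E₁ using Finset.induction_on generalizing f with
  | empty => simp [bernExp_empty]
  | insert a E ha ih =>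
    rw [Finset.disjoint_insert_left] at h
    rw [Finset.insert_union, bernExp_insert (by simp [ha, h.1]), bernExp_insert ha, ih h.2, ih h.2]
    simp only [Finset.insert_union]

/-- An element is missing from the union of the two independent sets with probability (1 - p)(1 -
q). -/
lemma bernExp_sprinkle (f : Finset α → ℝ) :
    bernExp (1 - (1 - p) * (1 - q)) E f =
      bernExp p E (fun S => bernExp q E (fun T => f (S ∪ T))) := by
  induction E using Finset.induction_on generalizing f with
  | empty => simp [bernExp_empty]
  | insert a E ha ih =>
    rw [bernExp_insert ha, bernExp_insert ha, ih, ih]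
    simp only [bernExp_insert ha, Finset.insert_union, Finset.union_insert, Finset.insert_idem]
    have key : ∀ (c c' : ℝ) (g g' : Finset α → ℝ), bernExp p E (fun S => c * g S + c' * g' S) =
        c * bernExp p E g + c' * bernExp p E g' := fun c c' g g' => by
      rw [bernExp_add (fun S => c * g S) (fun S => c' * g' S), bernExp_const_mul,
        bernExp_const_mul]
    rw [key, key]
    ring

/-- A bounded differences inequality, revealing one element at a time. The two conditional means
differ by at most c, and e^x ≤ 1 + x + x² for |x| ≤ 1; the linear terms cancel because m is the
average of m₁ and m₀, so each element costs a factor of at most 1 + (tc)². -/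
lemma bernExp_exp_sub_le (hp0 : 0 ≤ p) (hp1 : p ≤ 1) {c t : ℝ} (hc : 0 ≤ c) (ht : 0 ≤ t)
    (htc : t * c ≤ 1) (f : Finset α → ℝ)
    (hf : ∀ S ⊆ E, ∀ a ∈ E, a ∉ S → |f (insert a S) - f S| ≤ c) :
    bernExp p E (fun S => Real.exp (t * (f S - bernExp p E f))) ≤
      Real.exp (t ^ 2 * c ^ 2 * E.card) := by
  induction E using Finset.induction_on generalizing f with
  | empty => simp [bernExp_empty]
  | insert a E ha ih =>
    have hsub := Finset.subset_insert a E
    set m₁ := bernExp p E (fun S => f (insert a S)) with hm₁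
    set m₀ := bernExp p E f with hm₀
    have hm : bernExp p (insert a E) f = p * m₁ + (1 - p) * m₀ := bernExp_insert ha f
    have h₁ := ih (fun S => f (insert a S)) fun S hS b hb hbS => by
      rw [Finset.insert_comm]
      exact hf _ (Finset.insert_subset_insert a hS) b (hsub hb) (by
        rw [Finset.mem_insert]; rintro (rfl | h); exacts [ha hb, hbS h])
    have h₀ := ih f fun S hS b hb hbS => hf S (hS.trans hsub) b (hsub hb) hbS
    have hdiff : |m₁ - m₀| ≤ c := by
      have key : ∀ S ⊆ E, |f (insert a S) - f S| ≤ c := fun S hS =>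
        hf S (hS.trans hsub) a (Finset.mem_insert_self _ _) (fun h => ha (hS h))
      have e1 : m₁ ≤ bernExp p E (fun S => c + f S) :=
        bernExp_mono hp0 hp1 fun S hS => by linarith [(abs_le.1 (key S hS)).2]
      have e2 : m₀ ≤ bernExp p E (fun S => c + f (insert a S)) :=
        bernExp_mono hp0 hp1 fun S hS => by linarith [(abs_le.1 (key S hS)).1]
      rw [bernExp_add, bernExp_const] at e1 e2
      rw [abs_le]; constructor <;> linarith
    rw [hm, bernExp_insert ha]
    set m := p * m₁ + (1 - p) * m₀ with hmdef
    have hsplit : ∀ (g : Finset α → ℝ) (m' : ℝ),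
        bernExp p E (fun S => Real.exp (t * (g S - m))) =
          Real.exp (t * (m' - m)) * bernExp p E (fun S => Real.exp (t * (g S - m'))) := by
      intro g m'
      rw [← bernExp_const_mul]
      refine bernExp_congr fun S _ => ?_
      rw [← Real.exp_add]; ring_nf
    rw [hsplit _ m₁, hsplit _ m₀]
    set B := Real.exp (t ^ 2 * c ^ 2 * E.card) with hB
    have hBpos : 0 < B := Real.exp_pos _
    have hx : |t * (m₁ - m)| ≤ t * c := by
      rw [abs_mul, abs_of_nonneg ht]
      have : m₁ - m = (1 - p) * (m₁ - m₀) := by rw [hmdef]; ring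
      rw [this, abs_mul, abs_of_nonneg (by linarith : 0 ≤ 1 - p)]
      gcongr
      nlinarith [abs_nonneg (m₁ - m₀)]
    have hy : |t * (m₀ - m)| ≤ t * c := by
      rw [abs_mul, abs_of_nonneg ht]
      have : m₀ - m = -(p * (m₁ - m₀)) := by rw [hmdef]; ring
      rw [this, abs_neg, abs_mul, abs_of_nonneg hp0]
      gcongr
      nlinarith [abs_nonneg (m₁ - m₀)]
    have quad : ∀ x : ℝ, |x| ≤ t * c → Real.exp x ≤ 1 + x + (t * c) ^ 2 := by
      intro x hx
      have h1 := (abs_le.1 (Real.abs_exp_sub_one_sub_id_le (hx.trans htc))).2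
      have h2 : x ^ 2 ≤ (t * c) ^ 2 := sq_le_sq' (abs_le.1 hx).1 (abs_le.1 hx).2
      linarith
    calc p * (Real.exp (t * (m₁ - m)) *
              bernExp p E (fun S => Real.exp (t * (f (insert a S) - m₁)))) +
            (1 - p) * (Real.exp (t * (m₀ - m)) *
              bernExp p E (fun S => Real.exp (t * (f S - m₀))))
        ≤ p * ((1 + t * (m₁ - m) + (t * c) ^ 2) * B) +
            (1 - p) * ((1 + t * (m₀ - m) + (t * c) ^ 2) * B) := by
          have hq : 0 ≤ 1 - p := by linarith
          have hq : 0 ≤ 1 - p := by linarith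
          exact add_le_add
            (mul_le_mul_of_nonneg_left ((mul_le_mul_of_nonneg_left h₁ (Real.exp_pos _).le).trans
              (mul_le_mul_of_nonneg_right (quad _ hx) hBpos.le)) hp0)
            (mul_le_mul_of_nonneg_left ((mul_le_mul_of_nonneg_left h₀ (Real.exp_pos _).le).trans
              (mul_le_mul_of_nonneg_right (quad _ hy) hBpos.le)) hq)
      _ = (1 + (t * c) ^ 2) * B := by rw [hmdef]; ring
      _ ≤ Real.exp ((t * c) ^ 2) * B := by
          gcongr; linarith [Real.add_one_le_exp ((t * c) ^ 2)]
      _ = Real.exp (t ^ 2 * c ^ 2 * (insert a E).card) := by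
          rw [hB, ← Real.exp_add, Finset.card_insert_of_notMem ha]
          push_cast; ring_nf

lemma bernProb_mono (hp0 : 0 ≤ p) (hp1 : p ≤ 1) {Q Q' : Finset α → Prop}
    (h : ∀ S ⊆ E, Q S → Q' S) : bernProb p E Q ≤ bernProb p E Q' := by
  classical
  refine bernExp_mono hp0 hp1 fun S hS => ?_
  have := h S hS
  by_cases hQ : Q S
  · simp [hQ, this hQ]
  · simp only [hQ, if_false]; split_ifs <;> norm_num

lemma bernProb_nonneg (hp0 : 0 ≤ p) (hp1 : p ≤ 1) (Q : Finset α → Prop) :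
    0 ≤ bernProb p E Q := by
  rw [← bernExp_const (p := p) (E := E) 0]
  refine bernExp_mono hp0 hp1 fun S _ => ?_
  split_ifs <;> norm_num

lemma bernProb_compl (Q : Finset α → Prop) :
    bernProb p E (fun S => ¬ Q S) = 1 - bernProb p E Q := by
  have : bernProb p E (fun S => ¬ Q S) + bernProb p E Q = 1 := by
    rw [bernProb, bernProb, ← bernExp_add]
    refine (bernExp_congr fun S _ => ?_).trans bernExp_one
    by_cases h : Q S <;> simp [h]
  linarith

lemma bernProb_exists_le (hp0 : 0 ≤ p) (hp1 : p ≤ 1) {ι : Type*} (s : Finset ι)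
    (Q : ι → Finset α → Prop) :
    bernProb p E (fun S => ∃ i ∈ s, Q i S) ≤ ∑ i ∈ s, bernProb p E (Q i) := by
  classical
  simp only [bernProb]
  rw [← bernExp_sum]
  refine bernExp_mono hp0 hp1 fun S _ => ?_
  split_ifs with h
  · obtain ⟨i, hi, hQ⟩ := h
    refine le_trans ?_ (Finset.single_le_sum (f := fun i => if Q i S then (1 : ℝ) else 0) ?_ hi)
    · simp [hQ]
    · intro j _; split_ifs <;> norm_num
  · exact Finset.sum_nonneg fun j _ => by split_ifs <;> norm_num

lemma bernProb_eq_self {I : Finset α} (hI : I ⊆ E) :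
    bernProb p E (fun S => S = I) = p ^ I.card * (1 - p) ^ (E \ I).card := by
  rw [bernProb, bernExp, Finset.sum_eq_single I]
  · simp
  · intro b _ hb; simp [hb]
  · intro h; exact absurd (Finset.mem_powerset.2 hI) h

lemma bernProb_inter_eq {I T : Finset α} (hIT : I ⊆ T) (hT : T ⊆ E) :
    bernProb p E (fun S => S ∩ T = I) = p ^ I.card * (1 - p) ^ (T \ I).card := by
  have hE : E = T ∪ E \ T := (Finset.union_sdiff_of_subset hT).symm
  rw [← bernProb_eq_self hIT, bernProb, bernProb]
  conv_lhs => rw [hE]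
  rw [bernExp_union Finset.disjoint_sdiff]
  refine bernExp_congr fun S hS => ?_
  refine (bernExp_congr fun S' hS' => ?_).trans (bernExp_const (p := p) (E := E \ T) _)
  have : (S ∪ S') ∩ T = S := by
    ext x
    have h1 := @hS x
    have h2 := @hS' x
    simp only [Finset.mem_sdiff, Finset.mem_inter, Finset.mem_union] at *
    tauto
  rw [this]

/-- Disjoint sets are filled independently, each with probability at least q^L; the induction splits
off the last one. -/
lemma bernProb_forall_not_subset_le (hq0 : 0 ≤ q) (hq1 : q ≤ 1) (L m : ℕ)
    (P : ℕ → Finset α) (hP : ∀ i < m, P i ⊆ E) (hcard : ∀ i < m, (P i).card ≤ L)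
    (hdisj : ∀ i < m, ∀ j < i, Disjoint (P i) (P j)) :
    bernProb q E (fun S => ∀ i < m, ¬ P i ⊆ S) ≤ (1 - q ^ L) ^ m := by
  induction m generalizing E with
  | zero => simp [bernProb, bernExp_one]
  | succ m ih =>
    have hE : E = P m ∪ E \ P m := (Finset.union_sdiff_of_subset (hP m (by omega))).symm
    have ih' := ih (E := E \ P m)
      (fun i hi => Finset.subset_sdiff.2 ⟨hP i (by omega), (hdisj m (by omega) i hi).symm⟩)
      (fun i hi => hcard i (by omega)) (fun i hi j hj => hdisj i (by omega) j hj)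
    have hL : q ^ L ≤ q ^ (P m).card := pow_le_pow_of_le_one hq0 hq1 (hcard m (by omega))
    have hself := bernProb_eq_self (p := q) (Finset.Subset.refl (P m))
    have hle : bernProb q E (fun S => ∀ i < m + 1, ¬ P i ⊆ S) ≤
        bernProb q (P m) (fun S => ¬ S = P m) *
          bernProb q (E \ P m) (fun S => ∀ i < m, ¬ P i ⊆ S) := by
      rw [bernProb]
      conv_lhs => rw [hE]
      rw [bernExp_union Finset.disjoint_sdiff, mul_comm]
      refine le_of_le_of_eq (bernExp_mono hq0 hq1 fun S hS => ?_) (bernExp_const_mul _ _)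
      rw [mul_comm]
      refine le_of_le_of_eq ?_ (bernExp_const_mul _ _)
      refine bernExp_mono hq0 hq1 fun S' hS' => ?_
      by_cases h : ∀ i < m + 1, ¬ P i ⊆ S ∪ S'
      · have h1 : ¬ S = P m := fun e => h m (by omega) (e ▸ Finset.subset_union_left)
        have h2 : ∀ i < m, ¬ P i ⊆ S' := fun i hi hc =>
          h i (by omega) (hc.trans Finset.subset_union_right)
        rw [if_pos h1, if_pos h2]; split_ifs <;> norm_num
      · rw [if_neg h]; split_ifs <;> norm_num
    have hqL : 0 ≤ 1 - q ^ L := by linarith [pow_le_one₀ (n := L) hq0 hq1]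
    rw [bernProb_compl, hself] at hle
    simp only [sdiff_self, Finset.bot_eq_empty, Finset.card_empty, pow_zero, mul_one] at hle
    refine hle.trans ?_
    rw [pow_succ, mul_comm]
    exact mul_le_mul ih' (by linarith) (by linarith [pow_le_one₀ (n := (P m).card) hq0 hq1])
      (pow_nonneg hqL _)

end Bernoulli

/-! ### From the percolation measure to finite sums -/

namespace SimpleGraph

lemma bondPercolation_real {V : Type*} [Fintype V] [DecidableEq V] (G : SimpleGraph V)
    [DecidableRel G.Adj] (p : unitInterval) (Q : SimpleGraph V → Prop) :
    (G.bondPercolation p).real {H | Q H} =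
      bernProb (p : ℝ) G.edgeFinset (fun S => Q (fromEdgeSet (S : Set (Sym2 V)))) := by
  classical
  have hmeas : MeasurableSet {H : SimpleGraph V | Q H} := by
    have h : {H : SimpleGraph V | Q H} = edgeSet ⁻¹' {s | Q (fromEdgeSet s)} := by
      ext H; simp
    rw [h]
    exact measurable_edgeSet (Set.toFinite _).measurableSet
  rw [bondPercolation, map_measureReal_apply measurable_fromEdgeSet hmeas, measureReal_def,
    setBernoulli_apply_eq_apply_subsets, ← measureReal_def]
  have hset : {s | s ∈ fromEdgeSet ⁻¹' {H | Q H} ∧ s ⊆ G.edgeSet} =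
      ⋃ S ∈ G.edgeFinset.powerset.filter (fun S : Finset (Sym2 V) => Q (fromEdgeSet (S : Set (Sym2 V)))),
        {(S : Set (Sym2 V))} := by
    ext s
    simp only [Set.mem_iUnion, Finset.mem_filter, Finset.mem_powerset,
      Set.mem_singleton_iff, exists_prop]
    constructor
    · rintro ⟨h1, h2⟩
      refine ⟨s.toFinset, ⟨?_, by simpa using h1⟩, by simp⟩
      intro e he
      exact mem_edgeFinset.2 (h2 (by simpa using he))
    · rintro ⟨S, ⟨h1, h2⟩, rfl⟩
      exact ⟨h2, fun e he => mem_edgeFinset.1 (h1 he)⟩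
  rw [hset, measureReal_biUnion_finset, Finset.sum_filter, bernProb, bernExp]
  · refine Finset.sum_congr rfl fun S hS => ?_
    have hS' : (S : Set (Sym2 V)) ⊆ G.edgeSet := fun e he =>
      mem_edgeFinset.1 (Finset.mem_powerset.1 hS he)
    rw [setBernoulli_real_singleton p hS' (Set.toFinite _)]
    rw [← coe_edgeFinset, ← Finset.coe_sdiff, Set.ncard_coe_finset, Set.ncard_coe_finset]
    simp
  · intro S _ T _ h
    simpa [Function.onFun] using h
  · intro S _
    exact (Set.finite_singleton _).measurableSet

end SimpleGraph

/-! ### Clusters and vertices in small clusters -/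

namespace SimpleGraph

section Clusters

variable {V : Type*}

lemma Reachable.mem_of_closed {H : SimpleGraph V} {S : Set V}
    (hS : ∀ a ∈ S, ∀ b, H.Adj a b → b ∈ S) {v w : V} (h : H.Reachable v w) (hv : v ∈ S) :
    w ∈ S := by
  obtain ⟨p⟩ := h
  induction p with
  | nil => exact hv
  | cons hadj _ ih => exact ih (hS _ hv _ hadj)

lemma isAcyclic_of_card_lt_egirth [Fintype V] {H : SimpleGraph V}
    (h : (Fintype.card V : ℕ∞) < H.egirth) : H.IsAcyclic := by
  intro v c hc
  have h1 := egirth_le_length hc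
  have h2 : c.length ≤ Fintype.card V := by
    have := hc.support_nodup.length_le_card
    simpa using this
  exact absurd (h.trans_le h1) (by simpa using h2)

lemma egirth_le_egirth_induce (G : SimpleGraph V) (s : Set V) :
    G.egirth ≤ (G.induce s).egirth := by
  rw [le_egirth]
  intro a w hw
  have := egirth_le_length (hw.map (f := (Embedding.induce (G := G) s).toHom)
    Subtype.val_injective)
  rwa [Walk.length_map] at this

variable [Fintype V]

open Classical in
/-- The vertex set of the connected component of `v` in `H`. -/
noncomputable def cluster (H : SimpleGraph V) (v : V) : Finset V := {w | H.Reachable v w}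

/-- The vertices of `H` in components with fewer than `K` vertices. -/
noncomputable def smallVerts (H : SimpleGraph V) (K : ℕ) : Finset V :=
  {v | (H.cluster v).card < K}

variable {H H' : SimpleGraph V} {K : ℕ}

@[simp] lemma mem_cluster {v w : V} : w ∈ H.cluster v ↔ H.Reachable v w := by
  simp [cluster]

@[simp] lemma mem_smallVerts {v : V} : v ∈ H.smallVerts K ↔ (H.cluster v).card < K := by
  simp [smallVerts]

lemma mem_cluster_self (v : V) : v ∈ H.cluster v := mem_cluster.2 (Reachable.refl v)

lemma cluster_eq_of_reachable {v w : V} (h : H.Reachable v w) : H.cluster v = H.cluster w := by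
  ext x
  simp only [mem_cluster]
  exact ⟨fun hx => h.symm.trans hx, fun hx => h.trans hx⟩

lemma cluster_mono (h : H ≤ H') (v : V) : H.cluster v ⊆ H'.cluster v := fun _ hw =>
  mem_cluster.2 ((mem_cluster.1 hw).mono h)

lemma cluster_eq_of_adj_iff {v : V}
    (h : ∀ a ∈ H.cluster v, ∀ b, H'.Adj a b ↔ H.Adj a b) : H'.cluster v = H.cluster v := by
  apply Finset.Subset.antisymm
  · intro w hw
    refine (mem_cluster.1 hw).mem_of_closed (S := (H.cluster v : Set V)) ?_
      (Finset.mem_coe.2 (mem_cluster_self v))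
    intro a ha b hab
    rw [Finset.mem_coe, mem_cluster] at *
    exact ha.trans ((h a (mem_cluster.2 ha) b).1 hab).reachable
  · intro w hw
    refine ((mem_cluster.1 hw).mem_of_closed (S := (H.cluster v ∩ H'.cluster v : Set V)) ?_
      ⟨mem_cluster_self v, mem_cluster_self v⟩).2
    rintro a ⟨ha, ha'⟩ b hab
    rw [Finset.mem_coe] at ha ha'
    refine ⟨?_, ?_⟩ <;> rw [Finset.mem_coe, mem_cluster]
    · exact (mem_cluster.1 ha).trans hab.reachable
    · exact (mem_cluster.1 ha').trans ((h a ha b).2 hab).reachable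

lemma smallVerts_anti (h : H ≤ H') : H'.smallVerts K ⊆ H.smallVerts K := fun v hv =>
  mem_smallVerts.2 ((Finset.card_le_card (cluster_mono h v)).trans_lt (mem_smallVerts.1 hv))

/-- Adding the edge xy affects only the clusters of x and y, and each of these contributes fewer
than K vertices to the count if it is small and none otherwise. -/
lemma card_smallVerts_le_add_of_adj (x y : V)
    (h : ∀ a b, H'.Adj a b → H.Adj a b ∨ s(a, b) = s(x, y)) (hle : H ≤ H') :
    (H.smallVerts K).card ≤ (H'.smallVerts K).card + 2 * K := by
  classical
  have hsub : H.smallVerts K ⊆ H'.smallVerts K ∪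
      ((if (H.cluster x).card < K then H.cluster x else ∅) ∪
        (if (H.cluster y).card < K then H.cluster y else ∅)) := by
    intro v hv
    rw [mem_smallVerts] at hv
    by_cases hx : H.Reachable v x
    · rw [cluster_eq_of_reachable hx] at hv
      simp [hv, hx.symm]
    by_cases hy : H.Reachable v y
    · rw [cluster_eq_of_reachable hy] at hv
      simp [hv, hy.symm]
    refine Finset.mem_union_left _ ?_
    rw [mem_smallVerts, cluster_eq_of_adj_iff (H := H)]
    · exact hv
    · intro a ha b
      refine ⟨fun hab => (h a b hab).resolve_right fun he => ?_, fun hab => hle hab⟩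
      rw [mem_cluster] at ha
      rcases Sym2.eq_iff.1 he with ⟨rfl, _⟩ | ⟨rfl, _⟩
      exacts [hx ha, hy ha]
  refine (Finset.card_le_card hsub).trans ((Finset.card_union_le _ _).trans ?_)
  gcongr
  refine (Finset.card_union_le _ _).trans ?_
  have : ∀ z, (if (H.cluster z).card < K then H.cluster z else ∅).card ≤ K := by
    intro z; split_ifs with hz
    · exact hz.le
    · simp
  linarith [this x, this y]

variable [DecidableEq V]

lemma card_smallVerts_fromEdgeSet_insert (S : Finset (Sym2 V)) (e : Sym2 V) :
    ((fromEdgeSet (S : Set (Sym2 V))).smallVerts K).card ≤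
      ((fromEdgeSet ((insert e S : Finset (Sym2 V)) : Set (Sym2 V))).smallVerts K).card
        + 2 * K := by
  induction e with
  | h x y =>
    refine card_smallVerts_le_add_of_adj x y (fun a b hab => ?_)
      (fromEdgeSet_mono (by simp))
    rw [fromEdgeSet_adj] at hab ⊢
    obtain ⟨h1, h2⟩ := hab
    rw [Finset.coe_insert, Set.mem_insert_iff] at h1
    exact h1.elim Or.inr fun h => Or.inl ⟨h, h2⟩

lemma card_smallVerts_sdiff (F D : Finset (Sym2 V)) :
    ((fromEdgeSet ((F \ D : Finset (Sym2 V)) : Set (Sym2 V))).smallVerts K).card ≤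
      ((fromEdgeSet (F : Set (Sym2 V))).smallVerts K).card + 2 * K * D.card := by
  induction D using Finset.induction_on with
  | empty => simp
  | insert e D he ih =>
    rw [Finset.card_insert_of_notMem he]
    have h1 := card_smallVerts_fromEdgeSet_insert (K := K) (F \ insert e D) e
    have h2 : (fromEdgeSet ((insert e (F \ insert e D) : Finset (Sym2 V)) :
        Set (Sym2 V))).smallVerts K ⊆
          (fromEdgeSet ((F \ D : Finset (Sym2 V)) : Set (Sym2 V))).smallVerts K := by
      apply smallVerts_anti
      apply fromEdgeSet_mono
      rw [Finset.coe_subset]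
      intro z hz
      simp only [Finset.mem_sdiff, Finset.mem_insert, not_or] at hz ⊢
      tauto
    have h3 := Finset.card_le_card h2
    nlinarith

end Clusters

/-! ### Small clusters are trees when the girth is large -/

section SmallClusters

variable {V : Type*} [Fintype V] [DecidableEq V] {G : SimpleGraph V} [DecidableRel G.Adj]

lemma IsTree.card_edgeFinset_inter_sym2 {T : Finset V} (hT : (G.induce (T : Set V)).IsTree) :
    (G.edgeFinset ∩ T.sym2).card + 1 = T.card := by
  have h := hT.card_edgeFinset
  have h2 := congrArg Finset.card (map_edgeFinset_induce (s := (T : Set V)) (G := G))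
  rw [Finset.card_map, Finset.toFinset_coe] at h2
  have hc : Fintype.card (T : Set V) = T.card := by
    convert Fintype.card_coe T
    exact Finset.mem_coe
  rw [← h2, ← hc]
  convert h

/-- Double counting of incidences with T: an edge inside T is counted twice, any other edge touching
T once. -/
lemma IsRegularOfDegree.card_touching_add {d : ℕ} (hG : G.IsRegularOfDegree d) (T : Finset V) :
    (G.edgeFinset.filter (fun e => ∃ a ∈ T, a ∈ e)).card + (G.edgeFinset ∩ T.sym2).card =
      d * T.card := by
  have h1 : ∑ a ∈ T, (G.edgeFinset.filter (fun e => a ∈ e)).card = d * T.card := by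
    rw [Finset.sum_congr rfl (g := fun _ => d), Finset.sum_const, smul_eq_mul, mul_comm]
    intro a _
    rw [← incidenceFinset_eq_filter, card_incidenceFinset_eq_degree, hG]
  have h2 := Finset.sum_card_bipartiteAbove_eq_sum_card_bipartiteBelow
    (s := T) (t := G.edgeFinset) (fun a e => a ∈ e)
  simp only [Finset.bipartiteAbove, Finset.bipartiteBelow] at h2
  rw [← h1, h2, Finset.card_filter, ← Finset.filter_mem_eq_inter, Finset.card_filter,
    ← Finset.sum_add_distrib]
  refine Finset.sum_congr rfl fun e he => ?_
  induction e with
  | h x y =>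
    have hxy : x ≠ y := (mem_edgeFinset.1 he : G.Adj x y).ne
    have : T.filter (fun a => a ∈ s(x, y)) =
        (if x ∈ T then {x} else ∅) ∪ (if y ∈ T then {y} else ∅) := by
      ext a
      simp only [Finset.mem_filter, Sym2.mem_iff, Finset.mem_union]
      by_cases hx : x ∈ T <;> by_cases hy : y ∈ T <;> simp [hx, hy] <;> grind
    have hex : (∃ a ∈ T, a ∈ s(x, y)) ↔ x ∈ T ∨ y ∈ T := by
      constructor
      · rintro ⟨a, ha, hax⟩
        rcases Sym2.mem_iff.1 hax with rfl | rfl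
        exacts [Or.inl ha, Or.inr ha]
      · rintro (h | h)
        exacts [⟨x, h, Sym2.mem_mk_left x y⟩, ⟨y, h, Sym2.mem_mk_right x y⟩]
    rw [this]
    simp only [hex, Finset.mk_mem_sym2_iff]
    by_cases hx : x ∈ T <;> by_cases hy : y ∈ T <;> simp [hx, hy, hxy]

/-- The girth makes the induced graph on T acyclic, and a cluster is connected, so T induces a tree.
A tree is minimally connected, so every edge of it must be open, while edges leaving T must be
closed. The event thus prescribes the state of exactly the edges touching T. -/
lemma cluster_eq_iff_inter_eq {F F' : Finset (Sym2 V)} (hF : F ⊆ G.edgeFinset)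
    (hF' : F' ⊆ G.edgeFinset) {v : V} {T : Finset V}
    (hcl : (fromEdgeSet (F : Set (Sym2 V))).cluster v = T) (hT : (T.card : ℕ∞) < G.egirth) :
    (G.induce (T : Set V)).IsTree ∧
      ((fromEdgeSet (F' : Set (Sym2 V))).cluster v = T ↔
        F' ∩ G.edgeFinset.filter (fun e => ∃ a ∈ T, a ∈ e) = G.edgeFinset ∩ T.sym2) := by
  have hacyc : (G.induce (T : Set V)).IsAcyclic := by
    refine isAcyclic_of_card_lt_egirth (lt_of_lt_of_le ?_ (egirth_le_egirth_induce G _))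
    simpa using hT
  have main : ∀ F₁ : Finset (Sym2 V), F₁ ⊆ G.edgeFinset →
      (fromEdgeSet (F₁ : Set (Sym2 V))).cluster v = T →
      (G.induce (T : Set V)).IsTree ∧
        F₁ ∩ G.edgeFinset.filter (fun e => ∃ a ∈ T, a ∈ e) = G.edgeFinset ∩ T.sym2 := by
    intro F₁ hF₁ hcl₁
    have hle : fromEdgeSet (F₁ : Set (Sym2 V)) ≤ G := by
      intro a b hab
      exact mem_edgeFinset.1 (hF₁ (((fromEdgeSet_adj _).1 hab).1))
    have hconn : ((fromEdgeSet (F₁ : Set (Sym2 V))).induce (T : Set V)).Connected := by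
      have hsupp : (T : Set V) =
          ((fromEdgeSet (F₁ : Set (Sym2 V))).connectedComponentMk v).supp := by
        ext w
        rw [← hcl₁, Finset.mem_coe, mem_cluster, ConnectedComponent.mem_supp_iff,
          ConnectedComponent.eq]
        exact ⟨fun h => h.symm, fun h => h.symm⟩
      rw [hsupp]
      exact ConnectedComponent.connected_toSimpleGraph _
    have htree : (G.induce (T : Set V)).IsTree :=
      ⟨hconn.mono (fun a b hab => hle hab), hacyc⟩
    refine ⟨htree, ?_⟩
    have hmin := (isTree_iff_minimal_connected.1 htree).2 hconn (fun a b hab => hle hab)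
    ext e
    induction e with
    | h x y =>
      simp only [Finset.mem_inter, Finset.mem_filter, Finset.mk_mem_sym2_iff, Sym2.mem_iff]
      constructor
      · rintro ⟨h1, h2, a, ha, hax⟩
        refine ⟨h2, ?_⟩
        have hadj : (fromEdgeSet (F₁ : Set (Sym2 V))).Adj x y :=
          (fromEdgeSet_adj _).2 ⟨h1, (mem_edgeFinset.1 h2 : G.Adj x y).ne⟩
        rw [← hcl₁, mem_cluster] at ha
        rw [← hcl₁, mem_cluster, mem_cluster]
        rcases hax with rfl | rfl
        · exact ⟨ha, ha.trans hadj.reachable⟩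
        · exact ⟨ha.trans hadj.symm.reachable, ha⟩
      · rintro ⟨h1, hx, hy⟩
        have : (G.induce (T : Set V)).Adj ⟨x, hx⟩ ⟨y, hy⟩ := (mem_edgeFinset.1 h1 : G.Adj x y)
        exact ⟨((fromEdgeSet_adj _).1 (hmin this : (fromEdgeSet (F₁ : Set (Sym2 V))).Adj x y)).1,
          h1, x, hx, Or.inl rfl⟩
  obtain ⟨htree, hFT⟩ := main F hF hcl
  refine ⟨htree, fun h => (main F' hF' h).2, fun h => ?_⟩
  rw [← hcl]
  apply cluster_eq_of_adj_iff
  intro a ha b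
  rw [hcl] at ha
  simp only [fromEdgeSet_adj, Finset.mem_coe]
  refine and_congr_left fun _ => ?_
  have := Finset.ext_iff.1 (h.trans hFT.symm) s(a, b)
  simp only [Finset.mem_inter, Finset.mem_filter] at this
  constructor
  · intro h'; exact (this.1 ⟨h', hF' h', a, ha, by simp⟩).1
  · intro h'; exact (this.2 ⟨h', hF h', a, ha, by simp⟩).1

/-- The probability that a small connected set is a percolation cluster, in a graph of degree
`m + 2` and large girth: the set spans a tree, so its numbers of open and of closed edges are
determined by its cardinality. -/
lemma bernProb_cluster_eq {m : ℕ} (hG : G.IsRegularOfDegree (m + 2)) (v : V) {T : Finset V}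
    (hT : (T.card : ℕ∞) < G.egirth) :
    (∀ p, bernProb p G.edgeFinset
        (fun F => (fromEdgeSet (F : Set (Sym2 V))).cluster v = T) = 0) ∨
      ∃ j : ℕ, ∀ p, bernProb p G.edgeFinset
        (fun F => (fromEdgeSet (F : Set (Sym2 V))).cluster v = T) =
          p ^ j * (1 - p) ^ (m * (j + 1) + 2) := by
  by_cases h : ∃ F ⊆ G.edgeFinset, (fromEdgeSet (F : Set (Sym2 V))).cluster v = T
  · right
    obtain ⟨F, hF, hcl⟩ := h
    refine ⟨(G.edgeFinset ∩ T.sym2).card, fun p => ?_⟩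
    obtain ⟨htree, -⟩ := cluster_eq_iff_inter_eq hF hF hcl hT
    have h1 := htree.card_edgeFinset_inter_sym2
    have h2 := hG.card_touching_add T
    have hsub : G.edgeFinset ∩ T.sym2 ⊆ G.edgeFinset.filter (fun e => ∃ a ∈ T, a ∈ e) := by
      intro e
      induction e with
      | h x y =>
        simp only [Finset.mem_inter, Finset.mem_filter, Finset.mk_mem_sym2_iff]
        rintro ⟨h1, h2, h3⟩
        exact ⟨h1, x, h2, by simp⟩
    -- With j edges inside T and j + 1 vertices, the boundary has (m + 2)(j + 1) - 2j edges.
    have h3 : (G.edgeFinset.filter (fun e => ∃ a ∈ T, a ∈ e) \ (G.edgeFinset ∩ T.sym2)).card =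
        m * ((G.edgeFinset ∩ T.sym2).card + 1) + 2 := by
      rw [Finset.card_sdiff_of_subset hsub]
      rw [← h1] at h2
      have : (m + 2) * ((G.edgeFinset ∩ T.sym2).card + 1) =
        m * ((G.edgeFinset ∩ T.sym2).card + 1) + 2 + 2 * (G.edgeFinset ∩ T.sym2).card := by ring
      omega
    rw [← h3, ← bernProb_inter_eq hsub (Finset.filter_subset _ _)]
    unfold bernProb
    refine bernExp_congr fun F' hF' => ?_
    simp only [(cluster_eq_iff_inter_eq hF hF' hcl hT).2]
    congr
  · left
    intro p
    push Not at h
    rw [bernProb, bernExp_congr (g := fun _ => 0), bernExp_const]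
    intro F hF
    simp [h F hF]

end SmallClusters

end SimpleGraph

/-! ### Comparison with the critical parameter -/

/-- Apply 1 + u ≤ e^u to the normalized factors (m + 1)x and (1 - x)(m + 1)/m, both equal to 1 at
the maximum; in the product the exponentials cancel. -/
lemma mul_pow_le_critical {m : ℕ} (hm : 0 < m) {x : ℝ} (hx1 : x ≤ 1) :
    x * (1 - x) ^ m ≤ (1 / (m + 1)) * (1 - 1 / (m + 1)) ^ m := by
  have hm' : (0 : ℝ) < m := by exact_mod_cast hm
  have h1 : ((m : ℝ) + 1) * x ≤ Real.exp ((m + 1) * x - 1) := by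
    linarith [Real.add_one_le_exp (((m : ℝ) + 1) * x - 1)]
  have h2 : ((m : ℝ) + 1) / m * (1 - x) ≤ Real.exp (((m : ℝ) + 1) / m * (1 - x) - 1) := by
    linarith [Real.add_one_le_exp (((m : ℝ) + 1) / m * (1 - x) - 1)]
  have h3 : (((m : ℝ) + 1) / m * (1 - x)) ^ m ≤ Real.exp (-((m + 1) * x - 1)) := by
    refine (pow_le_pow_left₀ (by have : 0 ≤ 1 - x := by linarith
                                 positivity) h2 m).trans (le_of_eq ?_)
    rw [← Real.exp_nat_mul]
    congr 1
    field_simp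
    ring
  have h4 : (((m : ℝ) + 1) * x) * (((m : ℝ) + 1) / m * (1 - x)) ^ m ≤ 1 := by
    have h1x : 0 ≤ 1 - x := by linarith
    have hone : Real.exp ((m + 1) * x - 1) * Real.exp (-((m + 1) * x - 1)) = (1 : ℝ) := by
      rw [← Real.exp_add]; simp
    exact (mul_le_mul h1 h3 (by positivity) (Real.exp_pos _).le).trans hone.le
  have h5 : (1 : ℝ) - 1 / (m + 1) = m / (m + 1) := by field_simp; ring
  rw [h5]
  rw [mul_pow, div_pow] at h4
  rw [div_pow]
  have hA : (0 : ℝ) < (m : ℝ) ^ m := by positivity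
  have hB : (0 : ℝ) < ((m : ℝ) + 1) ^ m := by positivity
  rw [show ((m : ℝ) + 1) * x * (((m : ℝ) + 1) ^ m / (m : ℝ) ^ m * (1 - x) ^ m) =
    (x * (1 - x) ^ m) * ((m + 1) * ((m : ℝ) + 1) ^ m) / (m : ℝ) ^ m by ring,
    div_le_one hA] at h4
  rw [div_mul_div_comm, one_mul, le_div_iff₀ (by positivity)]
  exact h4

lemma bernProb_sum_eq {α β : Type*} [DecidableEq α] [DecidableEq β] (p : ℝ) (E : Finset α)
    (X : Finset α → β) (s : Finset β) :
    ∑ b ∈ s, bernProb p E (fun F => X F = b) = bernProb p E (fun F => X F ∈ s) := by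
  simp only [bernProb]
  rw [← bernExp_sum]
  refine bernExp_congr fun F _ => ?_
  by_cases h : X F ∈ s
  · rw [if_pos h]
    refine (Finset.sum_eq_single_of_mem (X F) h fun b _ hb => ?_).trans ?_
    · exact if_neg hb.symm
    · exact if_pos rfl
  · rw [if_neg h]
    refine Finset.sum_eq_zero fun b hb => ?_
    exact if_neg fun e : X F = b => h (e.symm ▸ hb)

lemma bernProb_le_one {α : Type*} [DecidableEq α] {p : ℝ} {E : Finset α} (hp0 : 0 ≤ p)
    (hp1 : p ≤ 1) (Q : Finset α → Prop) : bernProb p E Q ≤ 1 := by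
  have := bernProb_nonneg (E := E) hp0 hp1 (fun S => ¬ Q S)
  rw [bernProb_compl] at this
  linarith

namespace SimpleGraph

section SmallProbability

variable {V : Type*} [Fintype V] [DecidableEq V] {G : SimpleGraph V} [DecidableRel G.Adj]

/-- In a graph of degree `m + 2` and large girth, the probability that a percolation cluster is
small is at most its value at the critical parameter `1 / (m + 1)`, times a factor which is smaller
than one for supercritical `p`. -/
lemma bernProb_card_cluster_lt {m K : ℕ} (hm : 0 < m) (hG : G.IsRegularOfDegree (m + 2))
    (hK : (K : ℕ∞) < G.egirth) (v : V) {p : ℝ} (hp0 : 0 < p) (hp1 : p ≤ 1) :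
    bernProb p G.edgeFinset
        (fun F => ((fromEdgeSet (F : Set (Sym2 V))).cluster v).card < K) ≤
      (1 / (m + 1)) * (1 - p) ^ 2 / (p * (1 - 1 / (m + 1)) ^ 2) := by
  set p₀ : ℝ := 1 / (m + 1) with hp₀
  have hm' : (0 : ℝ) < m := by exact_mod_cast hm
  have hp₀pos : 0 < p₀ := by positivity
  have hp₀lt : p₀ < 1 := by rw [hp₀, div_lt_one (by positivity)]; linarith
  set ρ : ℝ := p₀ * (1 - p) ^ 2 / (p * (1 - p₀) ^ 2) with hρ
  have hden : 0 < p * (1 - p₀) ^ 2 := mul_pos hp0 (pow_pos (by linarith) 2)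
  have hρ0 : 0 ≤ ρ := by positivity
  have hsplit : ∀ q : ℝ, bernProb q G.edgeFinset
        (fun F => ((fromEdgeSet (F : Set (Sym2 V))).cluster v).card < K) =
      ∑ T ∈ (Finset.univ : Finset (Finset V)).filter (fun T => T.card < K),
        bernProb q G.edgeFinset (fun F => (fromEdgeSet (F : Set (Sym2 V))).cluster v = T) := by
    intro q
    rw [bernProb_sum_eq]
    simp
  have hterm : ∀ T ∈ (Finset.univ : Finset (Finset V)).filter (fun T => T.card < K),
      bernProb p G.edgeFinset (fun F => (fromEdgeSet (F : Set (Sym2 V))).cluster v = T) ≤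
        ρ * bernProb p₀ G.edgeFinset
          (fun F => (fromEdgeSet (F : Set (Sym2 V))).cluster v = T) := by
    intro T hT
    have hT' : (T.card : ℕ∞) < G.egirth :=
      lt_trans (by exact_mod_cast (Finset.mem_filter.1 hT).2) hK
    rcases bernProb_cluster_eq hG v hT' with h | ⟨j, h⟩
    · rw [h, h, mul_zero]
    · rw [h, h, hρ, div_mul_eq_mul_div, le_div_iff₀ hden]
      have hkey := pow_le_pow_left₀ (mul_nonneg hp0.le (pow_nonneg (by linarith) m))
        (mul_pow_le_critical hm hp1) (j + 1)
      -- The two surplus closed edges and the one missing open edge, relative to the power j + 1 of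
      -- x(1 - x)^m, are what produces the factor ρ.
      rw [← hp₀, mul_pow, mul_pow, ← pow_mul, ← pow_mul] at hkey
      calc p ^ j * (1 - p) ^ (m * (j + 1) + 2) * (p * (1 - p₀) ^ 2)
          = (p ^ (j + 1) * (1 - p) ^ (m * (j + 1))) * ((1 - p) ^ 2 * (1 - p₀) ^ 2) := by ring
        _ ≤ (p₀ ^ (j + 1) * (1 - p₀) ^ (m * (j + 1))) * ((1 - p) ^ 2 * (1 - p₀) ^ 2) := by
          gcongr
        _ = _ := by ring
  rw [hsplit]
  refine (Finset.sum_le_sum hterm).trans ?_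
  -- At p₀ the probabilities sum to at most 1, whatever K is.
  rw [← Finset.mul_sum, ← hsplit]
  exact mul_le_of_le_one_right hρ0 (bernProb_le_one hp₀pos.le hp₀lt.le _)

lemma bernExp_card_smallVerts {p ρ : ℝ} {K : ℕ} (E : Finset (Sym2 V))
    (h : ∀ v, bernProb p E
      (fun F => ((fromEdgeSet (F : Set (Sym2 V))).cluster v).card < K) ≤ ρ) :
    bernExp p E (fun F => (((fromEdgeSet (F : Set (Sym2 V))).smallVerts K).card : ℝ)) ≤
      ρ * Fintype.card V := by
  have : bernExp p E (fun F => (((fromEdgeSet (F : Set (Sym2 V))).smallVerts K).card : ℝ)) =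
      ∑ v, bernProb p E
        (fun F => ((fromEdgeSet (F : Set (Sym2 V))).cluster v).card < K) := by
    simp only [bernProb]
    rw [← bernExp_sum]
    refine bernExp_congr fun F _ => ?_
    rw [smallVerts, Finset.card_filter]
    push_cast
    exact Finset.sum_congr rfl fun v _ => by congr
  rw [this]
  refine (Finset.sum_le_sum fun v _ => h v).trans ?_
  simp [mul_comm]

/-- Concentration of the number of vertices in small clusters. -/
lemma bernProb_card_smallVerts_ge {p : ℝ} (hp0 : 0 ≤ p) (hp1 : p ≤ 1) {ρ t a : ℝ} {K : ℕ}
    (E : Finset (Sym2 V)) (ht : 0 ≤ t) (htK : t * (2 * K) ≤ 1)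
    (h : ∀ v, bernProb p E
      (fun F => ((fromEdgeSet (F : Set (Sym2 V))).cluster v).card < K) ≤ ρ) :
    bernProb p E (fun F => ρ * Fintype.card V + a ≤
        (((fromEdgeSet (F : Set (Sym2 V))).smallVerts K).card : ℝ)) ≤
      Real.exp (t ^ 2 * (2 * K) ^ 2 * E.card - t * a) := by
  have hmgf := bernExp_exp_sub_le hp0 hp1 (c := 2 * K) (t := t) (E := E) (by positivity) ht htK
    (fun F => (((fromEdgeSet (F : Set (Sym2 V))).smallVerts K).card : ℝ)) (by
      intro S _ e _ _
      have h1 := card_smallVerts_fromEdgeSet_insert (K := K) S e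
      have h2 : ((fromEdgeSet ((insert e S : Finset (Sym2 V)) : Set (Sym2 V))).smallVerts K).card
          ≤ ((fromEdgeSet (S : Set (Sym2 V))).smallVerts K).card :=
        Finset.card_le_card (smallVerts_anti (fromEdgeSet_mono (by simp)))
      have h1' : (((fromEdgeSet (S : Set (Sym2 V))).smallVerts K).card : ℝ) ≤
        ((fromEdgeSet ((insert e S : Finset (Sym2 V)) : Set (Sym2 V))).smallVerts K).card
          + 2 * K := by exact_mod_cast h1
      have h2' : (((fromEdgeSet ((insert e S : Finset (Sym2 V)) :
          Set (Sym2 V))).smallVerts K).card : ℝ)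
          ≤ ((fromEdgeSet (S : Set (Sym2 V))).smallVerts K).card := by exact_mod_cast h2
      rw [abs_le]; constructor <;> linarith)
  have hexp := bernExp_card_smallVerts E h
  set μ := bernExp p E
    (fun F => (((fromEdgeSet (F : Set (Sym2 V))).smallVerts K).card : ℝ)) with hμ
  -- Exponential Markov inequality, with the mean bounded by ρ times the number of vertices.
  rw [sub_eq_add_neg, Real.exp_add, mul_comm (Real.exp _)]
  refine le_trans ?_ (mul_le_mul_of_nonneg_left hmgf (Real.exp_pos _).le)
  rw [← bernExp_const_mul]
  refine bernExp_mono hp0 hp1 fun F _ => ?_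
  rw [← Real.exp_add]
  split_ifs with hF
  · rw [← Real.exp_zero]
    refine Real.exp_le_exp.2 ?_
    have : t * a ≤ t * ((((fromEdgeSet (F : Set (Sym2 V))).smallVerts K).card : ℝ) - μ) :=
      mul_le_mul_of_nonneg_left (by linarith) ht
    linarith
  · exact (Real.exp_pos _).le

end SmallProbability

end SimpleGraph

namespace SimpleGraph

/-! ### Depth first search -/

section Separation

variable {V : Type*} [Fintype V] [DecidableEq V] {H : SimpleGraph V}

/-- Depth first search: if all paths of `H` have at most `ℓ` vertices, then some set of at most `ℓ`
vertices separates a set `S`, which contains a prescribed number of elements of `W`, from the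
remaining vertices. -/
lemma exists_separation {ℓ j : ℕ} {W : Finset V} (hj : j ≤ W.card)
    (hℓ : ∀ l : List V, l.IsChain H.Adj → l.Nodup → l.length ≤ ℓ) :
    ∃ S U : Finset V, U.card ≤ ℓ ∧ (S ∩ W).card = j ∧
      ∀ a ∈ S, ∀ b, H.Adj a b → b ∈ S ∨ b ∈ U := by
  -- S holds the finished vertices and l the stack, which is always a path. A push lowers the number
  -- of unvisited vertices by one and lengthens the stack by one, a pop shortens the stack, so the
  -- weight 2 on unvisited vertices makes the measure decrease in both cases.
  have key : ∀ (N : ℕ) (S : Finset V) (l : List V),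
      2 * ((S ∪ l.toFinset)ᶜ).card + l.length ≤ N → l.IsChain H.Adj → l.Nodup →
      (∀ x ∈ l, x ∉ S) → (∀ a ∈ S, ∀ b, H.Adj a b → b ∈ S ∨ b ∈ l) → (S ∩ W).card ≤ j →
      ∃ S U : Finset V, U.card ≤ ℓ ∧ (S ∩ W).card = j ∧
        ∀ a ∈ S, ∀ b, H.Adj a b → b ∈ S ∨ b ∈ U := by
    intro N
    induction N with
    | zero =>
      intro S l hN hc hn hlS hS hSW
      have h1 : (S ∪ l.toFinset)ᶜ = ∅ := Finset.card_eq_zero.1 (by omega)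
      have h2 : l = [] := List.length_eq_zero_iff.1 (by omega)
      subst h2
      have h3 : S = Finset.univ := by simpa using h1
      refine ⟨S, ∅, by simp, le_antisymm hSW (by simpa [h3] using hj), fun a ha b hab => ?_⟩
      simpa using hS a ha b hab
    | succ N ih =>
      intro S l hN hc hn hlS hS hSW
      -- A step adds at most one vertex to S, so the count in W cannot jump over j; the search stops
      -- when it is reached.
      rcases hSW.eq_or_lt with heq | hlt
      · refine ⟨S, l.toFinset, ?_, heq, fun a ha b hab => by simpa using hS a ha b hab⟩
        exact (List.toFinset_card_le l).trans (hℓ l hc hn)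
      have push : ∀ t, t ∉ S → t ∉ l → (t :: l).IsChain H.Adj →
          ∃ S U : Finset V, U.card ≤ ℓ ∧ (S ∩ W).card = j ∧
            ∀ a ∈ S, ∀ b, H.Adj a b → b ∈ S ∨ b ∈ U := by
        intro t htS htl htc
        refine ih S (t :: l) ?_ htc (List.nodup_cons.2 ⟨htl, hn⟩) ?_ ?_ hSW
        · have hlt : ((S ∪ (t :: l).toFinset)ᶜ).card < ((S ∪ l.toFinset)ᶜ).card := by
            apply Finset.card_lt_card
            rw [Finset.ssubset_iff_of_subset]
            · exact ⟨t, by simp [htS, htl], by simp⟩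
            · intro x
              simp only [List.toFinset_cons, Finset.mem_compl, Finset.mem_union,
                Finset.mem_insert, List.mem_toFinset]
              tauto
          rw [List.length_cons]
          omega
        · intro x hx
          rcases List.mem_cons.1 hx with rfl | hx
          exacts [htS, hlS x hx]
        · intro a ha b hab
          exact (hS a ha b hab).imp_right (List.mem_cons_of_mem t)
      cases l with
      | nil =>
        obtain ⟨t, ht⟩ : ∃ t, t ∉ S := by
          by_contra! h
          rw [Finset.eq_univ_iff_forall.2 h, Finset.univ_inter] at hlt
          omega
        exact push t ht (by simp) (List.isChain_singleton t)
      | cons u l =>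
        by_cases hex : ∃ t, t ∉ S ∧ t ∉ u :: l ∧ H.Adj u t
        · obtain ⟨t, h1, h2, h3⟩ := hex
          exact push t h1 h2 (List.isChain_cons_cons.2 ⟨h3.symm, hc⟩)
        · push Not at hex
          rw [List.nodup_cons] at hn
          refine ih (insert u S) l ?_ hc.of_cons hn.2 ?_ ?_ ?_
          · have : insert u S ∪ l.toFinset = S ∪ (u :: l).toFinset := by
              rw [List.toFinset_cons, Finset.union_insert, Finset.insert_union]
            rw [this]
            rw [List.length_cons] at hN
            omega
          · intro x hx
            rw [Finset.mem_insert, not_or]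
            refine ⟨?_, hlS x (List.mem_cons_of_mem u hx)⟩
            rintro rfl
            exact hn.1 hx
          · intro a ha b hab
            rw [Finset.mem_insert] at ha ⊢
            have hb : b ∈ S ∨ b ∈ u :: l := by
              rcases ha with rfl | ha
              · by_contra! hcon
                exact hex b hcon.1 hcon.2 hab
              · exact hS a ha b hab
            rw [List.mem_cons] at hb
            tauto
          · have : insert u S ∩ W ⊆ insert u (S ∩ W) := by
              intro x; simp only [Finset.mem_inter, Finset.mem_insert]; tauto
            have h1 := Finset.card_le_card this
            have h2 := Finset.card_insert_le u (S ∩ W)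
            omega
  exact key _ ∅ [] le_rfl List.isChain_nil List.nodup_nil (by simp) (by simp) (by simp)

lemma length_le_of_not_hasPath {L : ℝ} {ℓ : ℕ} (hL : L ≤ ℓ)
    (h : ¬ H.HasPathOfLengthAtLeast L) (l : List V) (hc : l.IsChain H.Adj) (hn : l.Nodup) :
    l.length ≤ ℓ := by
  by_contra! hlt
  have hne : l ≠ [] := by rintro rfl; simp at hlt
  refine h ⟨_, _, Walk.ofSupport l hne hc, ?_, ?_⟩
  · rw [Walk.isPath_def, Walk.support_ofSupport]
    exact hn
  · rw [Walk.length_ofSupport]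
    refine hL.trans ?_
    exact_mod_cast (by omega : ℓ ≤ l.length - 1)

end Separation

/-! ### Joining large sets in an expander -/

section Connecting

variable {V : Type*} [Fintype V] [DecidableEq V]

/-- The edge set `P` joins `A` to `B`: every vertex set which contains `A` and is disjoint from `B`
is left by an edge of `P`. -/
def Joins (P : Finset (Sym2 V)) (A B : Finset V) : Prop :=
  ∀ S : Finset V, A ⊆ S → Disjoint S B → ∃ x ∈ S, ∃ y, y ∉ S ∧ s(x, y) ∈ P

lemma Joins.mono {P Q : Finset (Sym2 V)} {A B : Finset V} (h : Joins P A B) (hPQ : P ⊆ Q) :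
    Joins Q A B := fun S hA hB =>
  let ⟨x, hx, y, hy, hxy⟩ := h S hA hB
  ⟨x, hx, y, hy, hPQ hxy⟩

lemma Joins.insert_edge {P : Finset (Sym2 V)} {A : Finset V} {x y : V} (h : Joins P A {x}) :
    Joins (insert s(x, y) P) A {y} := by
  intro S hA hy
  by_cases hx : x ∈ S
  · exact ⟨x, hx, y, by simpa using hy, Finset.mem_insert_self _ _⟩
  · exact h.mono (Finset.subset_insert _ _) S hA (by simpa using hx)

/-- If the cut S misses x, then P crosses it; otherwise Q crosses the complementary cut, and hence
S. -/
lemma Joins.union {P Q : Finset (Sym2 V)} {A B : Finset V} {x : V} (hP : Joins P A {x})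
    (hQ : Joins Q B {x}) : Joins (P ∪ Q) A B := by
  intro S hA hB
  by_cases hx : x ∈ S
  · obtain ⟨y, hy, z, hz, hyz⟩ := hQ Sᶜ (by
      rw [Finset.subset_compl_iff_disjoint_right]; exact hB.symm) (by simpa using hx)
    refine ⟨z, by simpa using hz, y, by simpa using hy, Finset.mem_union_right _ ?_⟩
    rwa [Sym2.eq_swap]
  · exact hP.mono Finset.subset_union_left S hA (by simpa using hx)

open Classical in
/-- The vertices joined to `A` by at most `k` edges of `E`. -/
noncomputable def joinedWithin (E : Finset (Sym2 V)) (A : Finset V) (k : ℕ) : Finset V :=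
  {x | ∃ P ⊆ E, P.card ≤ k ∧ Joins P A {x}}

variable {E : Finset (Sym2 V)} {A : Finset V} {k : ℕ}

lemma mem_joinedWithin {x : V} :
    x ∈ joinedWithin E A k ↔ ∃ P ⊆ E, P.card ≤ k ∧ Joins P A {x} := by
  simp [joinedWithin]

lemma subset_joinedWithin : A ⊆ joinedWithin E A k := fun x hx =>
  mem_joinedWithin.2 ⟨∅, Finset.empty_subset _, by simp, fun S hA hS =>
    absurd (hA hx) (by simpa using hS)⟩

lemma joinedWithin_mono {k' : ℕ} (h : k ≤ k') : joinedWithin E A k ⊆ joinedWithin E A k' := by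
  intro x hx
  obtain ⟨P, h1, h2, h3⟩ := mem_joinedWithin.1 hx
  exact mem_joinedWithin.2 ⟨P, h1, h2.trans h, h3⟩

lemma mem_joinedWithin_succ {x y : V} (hx : x ∈ joinedWithin E A k) (hxy : s(x, y) ∈ E) :
    y ∈ joinedWithin E A (k + 1) := by
  obtain ⟨P, h1, h2, h3⟩ := mem_joinedWithin.1 hx
  refine mem_joinedWithin.2 ⟨insert s(x, y) P, Finset.insert_subset hxy h1, ?_, h3.insert_edge⟩
  exact (Finset.card_insert_le _ _).trans (by omega)

variable {G : SimpleGraph V} [DecidableRel G.Adj] {d : ℕ} {b α : ℝ}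

/-- A boundary edge of the k-ball outside D ends at a new vertex of the next ball, and each new
vertex receives at most d of them. -/
lemma card_interedges_le_of_joinedWithin (hG : G.IsRegularOfDegree d) (D : Finset (Sym2 V)) :
    (G.interedges (joinedWithin (G.edgeFinset \ D) A k)
        (joinedWithin (G.edgeFinset \ D) A k)ᶜ).card ≤
      D.card + ((joinedWithin (G.edgeFinset \ D) A (k + 1)) \
        (joinedWithin (G.edgeFinset \ D) A k)).card * d := by
  set R := joinedWithin (G.edgeFinset \ D) A k with hR
  set R' := joinedWithin (G.edgeFinset \ D) A (k + 1) with hR'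
  rw [← Finset.card_filter_add_card_filter_not (fun z : V × V => s(z.1, z.2) ∈ D)]
  apply Nat.add_le_add
  · refine Finset.card_le_card_of_injOn (fun z => s(z.1, z.2)) ?_ ?_
    · intro z hz
      exact (Finset.mem_filter.1 hz).2
    · rintro ⟨x, y⟩ hz ⟨x', y'⟩ hz' h
      have h1 := (mem_interedges_iff _).1 (Finset.mem_filter.1 hz).1
      have h2 := (mem_interedges_iff _).1 (Finset.mem_filter.1 hz').1
      rcases Sym2.eq_iff.1 h with ⟨rfl, rfl⟩ | ⟨rfl, rfl⟩
      · rfl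
      · exact absurd h1.1 (Finset.mem_compl.1 h2.2.1)
  · have hsub : (G.interedges R Rᶜ).filter (fun z : V × V => ¬ s(z.1, z.2) ∈ D) ⊆
        (R' \ R).biUnion (fun y => (G.neighborFinset y).image (fun x => (x, y))) := by
      rintro ⟨x, y⟩ hz
      obtain ⟨h1, h2⟩ := Finset.mem_filter.1 hz
      obtain ⟨hx, hy, hadj⟩ := (mem_interedges_iff _).1 h1
      refine Finset.mem_biUnion.2 ⟨y, Finset.mem_sdiff.2 ⟨?_, Finset.mem_compl.1 hy⟩, ?_⟩
      · exact mem_joinedWithin_succ hx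
          (Finset.mem_sdiff.2 ⟨mem_edgeFinset.2 hadj, h2⟩)
      · exact Finset.mem_image.2 ⟨x, by simpa using hadj.symm, rfl⟩
    refine (Finset.card_le_card hsub).trans (Finset.card_biUnion_le_card_mul _ _ _ fun y _ => ?_)
    refine Finset.card_image_le.trans ?_
    rw [card_neighborFinset_eq_degree, hG]

/-- While the ball has at most n/2 vertices, its boundary has at least bαn edges. At most half of
them lie in D, so the ball gains at least bαn/(2d) vertices per step. This linear growth suffices,
since N need only be independent of n. -/
lemma half_lt_card_joinedWithin (hG : G.IsRegularOfDegree d) (hexp : G.IsExpander b d)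
    (hd : 0 < d) (hb : 0 < b) (hV : 0 < Fintype.card V)
    (hA : α * Fintype.card V ≤ A.card) (D : Finset (Sym2 V))
    (hD : (D.card : ℝ) ≤ b * α / 2 * Fintype.card V) {N : ℕ} (hN : 1 < N * (b * α / d)) :
    Fintype.card V < 2 * (joinedWithin (G.edgeFinset \ D) A N).card := by
  set n := Fintype.card V with hn
  have hn' : (0 : ℝ) < n := by exact_mod_cast hV
  have hd' : (0 : ℝ) < d := by exact_mod_cast hd
  have key : ∀ k, n < 2 * (joinedWithin (G.edgeFinset \ D) A k).card ∨
      k * (b * α / (2 * d)) * n ≤ (joinedWithin (G.edgeFinset \ D) A k).card := by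
    intro k
    induction k with
    | zero => right; simp
    | succ k ih =>
      have hmono := joinedWithin_mono (E := G.edgeFinset \ D) (A := A) (Nat.le_succ k)
      by_cases hlt : n < 2 * (joinedWithin (G.edgeFinset \ D) A k).card
      · left; have := Finset.card_le_card hmono; simp only [Nat.succ_eq_add_one] at this; omega
      · right
        have ih' := ih.resolve_left hlt
        have h1 := hexp.2 _ (not_lt.1 hlt)
        have h2 := card_interedges_le_of_joinedWithin (A := A) (k := k) hG D
        have h3 := Finset.card_sdiff_add_card_eq_card hmono
        have h4 : (A.card : ℝ) ≤ (joinedWithin (G.edgeFinset \ D) A k).card := by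
          exact_mod_cast Finset.card_le_card subset_joinedWithin
        have h2' : ((G.interedges (joinedWithin (G.edgeFinset \ D) A k)
            (joinedWithin (G.edgeFinset \ D) A k)ᶜ).card : ℝ) ≤
          D.card + ((joinedWithin (G.edgeFinset \ D) A (k + 1)) \
            (joinedWithin (G.edgeFinset \ D) A k)).card * d := by exact_mod_cast h2
        have h3' : (((joinedWithin (G.edgeFinset \ D) A (k + 1)) \
            (joinedWithin (G.edgeFinset \ D) A k)).card : ℝ) +
              (joinedWithin (G.edgeFinset \ D) A k).card =
            (joinedWithin (G.edgeFinset \ D) A (k + 1)).card := by exact_mod_cast h3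
        have h5 : b * (α * n) ≤ b * (joinedWithin (G.edgeFinset \ D) A k).card :=
          mul_le_mul_of_nonneg_left (hA.trans h4) hb.le
        have h6 : b * α / 2 * n ≤ ((joinedWithin (G.edgeFinset \ D) A (k + 1)) \
            (joinedWithin (G.edgeFinset \ D) A k)).card * (d : ℝ) := by linarith
        have h7 : b * α / (2 * d) * n ≤ ((joinedWithin (G.edgeFinset \ D) A (k + 1)) \
            (joinedWithin (G.edgeFinset \ D) A k)).card := by
          rw [← div_le_iff₀ hd'] at h6
          refine le_trans (le_of_eq ?_) h6
          field_simp
        push_cast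
        linarith
  rcases key N with h | h
  · exact h
  · have h1 : (N : ℝ) * (b * α / (2 * d)) * n = N * (b * α / d) * n / 2 := by
      field_simp
    rw [h1] at h
    have h2 : (n : ℝ) < N * (b * α / d) * n := by nlinarith
    have h3 : (n : ℝ) < 2 * (joinedWithin (G.edgeFinset \ D) A N).card := by linarith
    exact_mod_cast h3

/-- The balls around A and B each contain more than half of the vertices, so they meet. -/
lemma exists_joins (hG : G.IsRegularOfDegree d) (hexp : G.IsExpander b d)
    (hd : 0 < d) (hb : 0 < b) (hV : 0 < Fintype.card V) {B : Finset V}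
    (hA : α * Fintype.card V ≤ A.card) (hB : α * Fintype.card V ≤ B.card) (D : Finset (Sym2 V))
    (hD : (D.card : ℝ) ≤ b * α / 2 * Fintype.card V) {N : ℕ} (hN : 1 < N * (b * α / d)) :
    ∃ P ⊆ G.edgeFinset \ D, P.card ≤ 2 * N ∧ Joins P A B := by
  have h1 := half_lt_card_joinedWithin hG hexp hd hb hV hA D hD hN
  have h2 := half_lt_card_joinedWithin hG hexp hd hb hV hB D hD hN
  obtain ⟨x, hx⟩ : (joinedWithin (G.edgeFinset \ D) A N ∩
      joinedWithin (G.edgeFinset \ D) B N).Nonempty := by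
    rw [← Finset.card_pos]
    have h3 := Finset.card_union_add_card_inter (joinedWithin (G.edgeFinset \ D) A N)
      (joinedWithin (G.edgeFinset \ D) B N)
    have h4 := Finset.card_le_univ (joinedWithin (G.edgeFinset \ D) A N ∪
      joinedWithin (G.edgeFinset \ D) B N)
    omega
  rw [Finset.mem_inter] at hx
  obtain ⟨P, hP, hPc, hPj⟩ := mem_joinedWithin.1 hx.1
  obtain ⟨Q, hQ, hQc, hQj⟩ := mem_joinedWithin.1 hx.2
  exact ⟨P ∪ Q, Finset.union_subset hP hQ, (Finset.card_union_le _ _).trans (by omega),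
    hPj.union hQj⟩

/-- Greedy choice: the edges already used are added to the forbidden set. -/
lemma exists_disjoint_joins (hG : G.IsRegularOfDegree d) (hexp : G.IsExpander b d)
    (hd : 0 < d) (hb : 0 < b) (hV : 0 < Fintype.card V) {B : Finset V}
    (hA : α * Fintype.card V ≤ A.card) (hB : α * Fintype.card V ≤ B.card) (D : Finset (Sym2 V))
    {N : ℕ} (hN : 1 < N * (b * α / d)) (m : ℕ)
    (hD : (D.card : ℝ) + m * (2 * N) ≤ b * α / 2 * Fintype.card V) :
    ∃ P : ℕ → Finset (Sym2 V), (∀ i < m, P i ⊆ G.edgeFinset \ D ∧ (P i).card ≤ 2 * N ∧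
      Joins (P i) A B) ∧ ∀ i < m, ∀ j < i, Disjoint (P i) (P j) := by
  induction m with
  | zero => exact ⟨fun _ => ∅, by simp, by simp⟩
  | succ m ih =>
    push_cast at hD
    obtain ⟨P, hP, hdisj⟩ := ih (by nlinarith)
    have hcard : ((D ∪ (Finset.range m).biUnion P).card : ℝ) ≤ b * α / 2 * Fintype.card V := by
      have h1 := Finset.card_union_le D ((Finset.range m).biUnion P)
      have h2 : ((Finset.range m).biUnion P).card ≤ m * (2 * N) := by
        refine (Finset.card_biUnion_le_card_mul _ _ (2 * N) fun i hi => ?_).trans (by simp)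
        exact (hP i (Finset.mem_range.1 hi)).2.1
      have h3 : ((D ∪ (Finset.range m).biUnion P).card : ℝ) ≤ D.card + m * (2 * N) := by
        exact_mod_cast h1.trans (Nat.add_le_add_left h2 _)
      have : (0 : ℝ) ≤ N := Nat.cast_nonneg N
      linarith
    obtain ⟨Q, hQ, hQc, hQj⟩ := exists_joins hG hexp hd hb hV hA hB _ hcard hN
    refine ⟨Function.update P m Q, fun i hi => ?_, fun i hi j hj => ?_⟩
    · rcases Nat.lt_succ_iff_lt_or_eq.1 hi with hi | rfl
      · rw [Function.update_of_ne hi.ne]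
        exact hP i hi
      · rw [Function.update_self]
        exact ⟨hQ.trans (Finset.sdiff_subset_sdiff le_rfl Finset.subset_union_left), hQc, hQj⟩
    · have hjm : j < m := by omega
      rw [Function.update_of_ne hjm.ne]
      rcases Nat.lt_succ_iff_lt_or_eq.1 hi with hi | rfl
      · rw [Function.update_of_ne hi.ne]
        exact hdisj i hi j hj
      · rw [Function.update_self]
        refine (Finset.subset_sdiff.1 hQ).2.mono_right ?_
        exact (Finset.subset_biUnion_of_mem P (Finset.mem_range.2 hjm)).trans
          Finset.subset_union_right

/-- In percolation on an expander, two large sets are joined with overwhelming probability, even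
after the removal of a small set of edges. -/
lemma bernProb_not_joins_le (hG : G.IsRegularOfDegree d) (hexp : G.IsExpander b d)
    (hd : 0 < d) (hb : 0 < b) (hV : 0 < Fintype.card V) {B : Finset V}
    (hA : α * Fintype.card V ≤ A.card) (hB : α * Fintype.card V ≤ B.card) (D : Finset (Sym2 V))
    {N : ℕ} (hN : 1 < N * (b * α / d)) (m : ℕ)
    (hD : (D.card : ℝ) + m * (2 * N) ≤ b * α / 2 * Fintype.card V)
    {q : ℝ} (hq0 : 0 ≤ q) (hq1 : q ≤ 1) :
    bernProb q G.edgeFinset (fun F => ¬ Joins (F \ D) A B) ≤ (1 - q ^ (2 * N)) ^ m := by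
  obtain ⟨P, hP, hdisj⟩ := exists_disjoint_joins hG hexp hd hb hV hA hB D hN m hD
  refine le_trans (bernProb_mono hq0 hq1 fun F _ hF i hi hPF => hF ?_)
    (bernProb_forall_not_subset_le hq0 hq1 (2 * N) m P
      (fun i hi => (hP i hi).1.trans Finset.sdiff_subset) (fun i hi => (hP i hi).2.1) hdisj)
  exact (hP i hi).2.2.mono
    (Finset.subset_sdiff.2 ⟨hPF, (Finset.subset_sdiff.1 (hP i hi).1).2⟩)

end Connecting

end SimpleGraph

namespace SimpleGraph

/-! ### Dividing the big clusters, and the union bound -/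

section BigClusters

variable {V : Type*} [Fintype V] [DecidableEq V]

/-- The vertex sets of the components of `H` with at least `K` vertices. -/
noncomputable def bigClusters (H : SimpleGraph V) (K : ℕ) : Finset (Finset V) :=
  (Finset.univ.image H.cluster).filter (fun C => K ≤ C.card)

lemma card_bigClusters_mul_le (H : SimpleGraph V) (K : ℕ) :
    (H.bigClusters K).card * K ≤ Fintype.card V := by
  have hdisj : ((H.bigClusters K : Finset (Finset V)) : Set (Finset V)).PairwiseDisjoint id := by
    intro C hC C' hC' hne
    obtain ⟨v, -, rfl⟩ := Finset.mem_image.1 (Finset.mem_filter.1 hC).1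
    obtain ⟨w, -, rfl⟩ := Finset.mem_image.1 (Finset.mem_filter.1 hC').1
    refine Finset.disjoint_left.2 fun a ha ha' => hne ?_
    simp only [id, mem_cluster] at ha ha'
    rw [cluster_eq_of_reachable ha, cluster_eq_of_reachable ha']
  calc (H.bigClusters K).card * K ≤ ∑ C ∈ H.bigClusters K, (id C).card := by
        rw [← smul_eq_mul]
        exact Finset.card_nsmul_le_sum _ _ _ fun C hC => (Finset.mem_filter.1 hC).2
    _ = ((H.bigClusters K).biUnion id).card := (Finset.card_biUnion hdisj).symm
    _ ≤ Fintype.card V := Finset.card_le_univ _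

/-- The edges of `G` with an end in `U`. -/
def edgesTouching (G : SimpleGraph V) [DecidableRel G.Adj] (U : Finset V) : Finset (Sym2 V) :=
  G.edgeFinset.filter (fun e => ∃ a ∈ U, a ∈ e)

variable {G : SimpleGraph V} [DecidableRel G.Adj] {d : ℕ}

lemma IsRegularOfDegree.card_edgesTouching_le (hG : G.IsRegularOfDegree d) (U : Finset V) :
    (G.edgesTouching U).card ≤ d * U.card :=
  Nat.le.intro (hG.card_touching_add U)

lemma notMem_of_mem_sdiff_edgesTouching {F : Finset (Sym2 V)} (hF : F ⊆ G.edgeFinset)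
    {U : Finset V} {a b : V} (h : s(a, b) ∈ F \ G.edgesTouching U) : b ∉ U := fun hb =>
  (Finset.mem_sdiff.1 h).2
    (Finset.mem_filter.2 ⟨hF (Finset.mem_sdiff.1 h).1, b, hb, Sym2.mem_mk_right a b⟩)

/-- If the union of two edge sets contains no long path, then for some small vertex set `U` the big
clusters of the first edge set outside of `U` can be divided into two large groups which are not
joined by the second one. -/
lemma exists_not_joins (hG : G.IsRegularOfDegree d) {F₁ F₂ : Finset (Sym2 V)}
    (hF₁ : F₁ ⊆ G.edgeFinset) (hF₂ : F₂ ⊆ G.edgeFinset) {ℓ K j : ℕ}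
    (hℓ : ∀ l : List V, l.IsChain (fromEdgeSet ((F₁ ∪ F₂ : Finset (Sym2 V)) : Set (Sym2 V))).Adj →
      l.Nodup → l.length ≤ ℓ)
    (hj : j + ((fromEdgeSet (F₁ : Set (Sym2 V))).smallVerts K).card ≤ Fintype.card V) :
    ∃ U : Finset V, U.card ≤ ℓ ∧
      ∃ σ ⊆ (fromEdgeSet ((F₁ \ G.edgesTouching U : Finset (Sym2 V)) :
          Set (Sym2 V))).bigClusters K,
        j ≤ (σ.biUnion id).card + 2 * K * (d * ℓ) ∧
        Fintype.card V ≤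
          (((fromEdgeSet ((F₁ \ G.edgesTouching U : Finset (Sym2 V)) :
            Set (Sym2 V))).bigClusters K \ σ).biUnion id).card + j +
            ((fromEdgeSet (F₁ : Set (Sym2 V))).smallVerts K).card + 2 * K * (d * ℓ) ∧
        ¬ Joins (F₂ \ G.edgesTouching U) (σ.biUnion id)
          (((fromEdgeSet ((F₁ \ G.edgesTouching U : Finset (Sym2 V)) :
            Set (Sym2 V))).bigClusters K \ σ).biUnion id) := by
  set H₁ := fromEdgeSet (F₁ : Set (Sym2 V)) with hH₁
  obtain ⟨S, U, hU, hSW, hsep⟩ := exists_separation (j := j) (W := (H₁.smallVerts K)ᶜ)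
    (by rw [Finset.card_compl]; omega) hℓ
  refine ⟨U, hU, ?_⟩
  set H₁' := fromEdgeSet ((F₁ \ G.edgesTouching U : Finset (Sym2 V)) : Set (Sym2 V)) with hH₁'
  have hsmall : H₁.smallVerts K ⊆ H₁'.smallVerts K :=
    smallVerts_anti (fromEdgeSet_mono (by simp))
  have hcard : (H₁'.smallVerts K).card ≤ (H₁.smallVerts K).card + 2 * K * (d * ℓ) := by
    refine (card_smallVerts_sdiff F₁ (G.edgesTouching U)).trans ?_
    gcongr
    exact (hG.card_edgesTouching_le U).trans (Nat.mul_le_mul_left d hU)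
  -- An edge of F₁ leaving S must end in U, and those edges have been deleted.
  have hclosed : ∀ v ∈ S, H₁'.cluster v ⊆ S := by
    intro v hv w hw
    refine (mem_cluster.1 hw).mem_of_closed (S := (S : Set V)) (fun a ha b hab => ?_) hv
    rw [hH₁', fromEdgeSet_adj, Finset.mem_coe] at hab
    refine (hsep a ha b ?_).resolve_right (notMem_of_mem_sdiff_edgesTouching hF₁ hab.1)
    rw [fromEdgeSet_adj, Finset.mem_coe]
    exact ⟨Finset.mem_union_left _ (Finset.mem_sdiff.1 hab.1).1, hab.2⟩
  have hbig : ∀ v, v ∉ H₁'.smallVerts K → H₁'.cluster v ∈ H₁'.bigClusters K := fun v hv =>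
    Finset.mem_filter.2 ⟨Finset.mem_image_of_mem _ (Finset.mem_univ v),
      not_lt.1 fun h => hv (mem_smallVerts.2 h)⟩
  have hAcard : (((H₁'.smallVerts K)ᶜ ∩ S).card) ≤
      (((H₁'.bigClusters K).filter (· ⊆ S)).biUnion id).card := by
    refine Finset.card_le_card fun v hv => ?_
    rw [Finset.mem_inter, Finset.mem_compl] at hv
    exact Finset.mem_biUnion.2 ⟨H₁'.cluster v,
      Finset.mem_filter.2 ⟨hbig v hv.1, hclosed v hv.2⟩, mem_cluster_self v⟩
  have hBcard : (((H₁'.smallVerts K)ᶜ \ S).card) ≤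
      ((H₁'.bigClusters K \ (H₁'.bigClusters K).filter (· ⊆ S)).biUnion id).card := by
    refine Finset.card_le_card fun v hv => ?_
    rw [Finset.mem_sdiff, Finset.mem_compl] at hv
    refine Finset.mem_biUnion.2 ⟨H₁'.cluster v, Finset.mem_sdiff.2 ⟨hbig v hv.1, fun h => ?_⟩,
      mem_cluster_self v⟩
    exact hv.2 ((Finset.mem_filter.1 h).2 (mem_cluster_self v))
  -- Every big cluster lies inside S or is disjoint from it. The error 2Kdℓ in both counts bounds
  -- the vertices whose clusters became small when the edges at U were deleted.
  refine ⟨(H₁'.bigClusters K).filter (· ⊆ S), Finset.filter_subset _ _, ?_, ?_, ?_⟩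
  · have h1 : S ∩ (H₁.smallVerts K)ᶜ ⊆
        ((H₁'.smallVerts K)ᶜ ∩ S) ∪ (H₁'.smallVerts K \ H₁.smallVerts K) := by
      intro v
      simp only [Finset.mem_inter, Finset.mem_compl, Finset.mem_union, Finset.mem_sdiff]
      tauto
    have h2 := (Finset.card_le_card h1).trans (Finset.card_union_le _ _)
    rw [Finset.card_sdiff_of_subset hsmall] at h2
    omega
  · have h1 : (H₁'.smallVerts K)ᶜ ∩ S ⊆ S ∩ (H₁.smallVerts K)ᶜ := by
      intro v
      simp only [Finset.mem_inter, Finset.mem_compl]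
      exact fun h => ⟨h.2, fun h' => h.1 (hsmall h')⟩
    have h2 := Finset.card_le_card h1
    have h3 := Finset.card_inter_add_card_sdiff (H₁'.smallVerts K)ᶜ S
    rw [Finset.card_compl] at h3
    have h4 := Finset.card_le_univ (H₁'.smallVerts K)
    omega
  · intro hjoin
    obtain ⟨x, hx, y, hy, hxy⟩ := hjoin S
      (Finset.biUnion_subset.2 fun C hC => (Finset.mem_filter.1 hC).2) (by
        rw [Finset.disjoint_biUnion_right]
        intro C hC
        obtain ⟨hC1, hC2⟩ := Finset.mem_sdiff.1 hC
        obtain ⟨v, -, rfl⟩ := Finset.mem_image.1 (Finset.mem_filter.1 hC1).1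
        refine Finset.disjoint_left.2 fun a ha ha' => hC2 (Finset.mem_filter.2 ⟨hC1, ?_⟩)
        rw [id, mem_cluster] at ha'
        rw [cluster_eq_of_reachable ha']
        exact hclosed a ha)
    refine ((hsep x hx y ?_).resolve_left hy) |> notMem_of_mem_sdiff_edgesTouching hF₂ hxy
    rw [fromEdgeSet_adj, Finset.mem_coe]
    exact ⟨Finset.mem_union_right _ (Finset.mem_sdiff.1 hxy).1, by rintro rfl; exact hy hx⟩

/-- Weight each set U by e^(-y|U|): the total weight is (1 + e^(-y))^n, and each counted set has
weight at least e^(-yℓ). -/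
lemma card_filter_card_le_exp (ℓ : ℕ) {y : ℝ} (hy : 0 ≤ y) :
    (((Finset.univ : Finset (Finset V)).filter (fun U => U.card ≤ ℓ)).card : ℝ) ≤
      Real.exp (y * ℓ + Real.exp (-y) * Fintype.card V) := by
  have h1 : ∑ U : Finset V, Real.exp (-y) ^ U.card = (Real.exp (-y) + 1) ^ Fintype.card V := by
    simpa using Fintype.sum_pow_mul_eq_add_pow V (Real.exp (-y)) 1
  have h2 : (((Finset.univ : Finset (Finset V)).filter (fun U => U.card ≤ ℓ)).card : ℝ) *
      Real.exp (-y * ℓ) ≤ ∑ U : Finset V, Real.exp (-y) ^ U.card := by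
    rw [← nsmul_eq_mul]
    refine (Finset.card_nsmul_le_sum _ (fun U : Finset V => Real.exp (-y) ^ U.card) _
      fun U hU => ?_).trans
      (Finset.sum_le_sum_of_subset_of_nonneg (Finset.filter_subset _ _) fun U _ _ => by positivity)
    have hU' : (U.card : ℝ) ≤ ℓ := by exact_mod_cast (Finset.mem_filter.1 hU).2
    rw [← Real.exp_nat_mul, Real.exp_le_exp]
    nlinarith
  have h3 : (Real.exp (-y) + 1) ^ Fintype.card V ≤
      Real.exp (Real.exp (-y) * Fintype.card V) := by
    rw [mul_comm, Real.exp_nat_mul]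
    exact pow_le_pow_left₀ (by positivity) (Real.add_one_le_exp _) _
  have h4 := h2.trans (h1.le.trans h3)
  rw [Real.exp_add, mul_comm]
  calc _ = (((Finset.univ : Finset (Finset V)).filter (fun U => U.card ≤ ℓ)).card : ℝ) *
        Real.exp (-y * ℓ) * Real.exp (y * ℓ) := by
        rw [mul_assoc, ← Real.exp_add]; simp
    _ ≤ _ := mul_le_mul_of_nonneg_right h4 (Real.exp_pos _).le

/-- Sprinkling: if few vertices lie in small clusters of `F₁`, then it is unlikely that adding a
percolation configuration to `F₁` does not create a long path. -/
lemma bernProb_not_hasPath_le {b α : ℝ} (hG : G.IsRegularOfDegree d) (hexp : G.IsExpander b d)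
    (hd : 0 < d) (hb : 0 < b) (hV : 0 < Fintype.card V) {F₁ : Finset (Sym2 V)}
    (hF₁ : F₁ ⊆ G.edgeFinset) {ℓ K j N m : ℕ} {L y q : ℝ} (hL : L ≤ ℓ) (hK : 0 < K) (hy : 0 ≤ y)
    (hq0 : 0 ≤ q) (hq1 : q ≤ 1) (hN : 1 < N * (b * α / d))
    (hm : (d * ℓ : ℝ) + m * (2 * N) ≤ b * α / 2 * Fintype.card V)
    (hj : j + ((fromEdgeSet (F₁ : Set (Sym2 V))).smallVerts K).card ≤ Fintype.card V)
    (hA : α * Fintype.card V + 2 * K * (d * ℓ) ≤ j)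
    (hB : α * Fintype.card V + j + ((fromEdgeSet (F₁ : Set (Sym2 V))).smallVerts K).card +
      2 * K * (d * ℓ) ≤ Fintype.card V) :
    bernProb q G.edgeFinset (fun F₂ => ¬ (fromEdgeSet ((F₁ ∪ F₂ : Finset (Sym2 V)) :
        Set (Sym2 V))).HasPathOfLengthAtLeast L) ≤
      Real.exp (y * ℓ + Real.exp (-y) * Fintype.card V + Fintype.card V / K) *
        (1 - q ^ (2 * N)) ^ m := by
  classical
  set Us := (Finset.univ : Finset (Finset V)).filter (fun U => U.card ≤ ℓ) with hUs
  -- These clusters depend on F₁ and U only, so for given U and σ the two sets to be joined are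
  -- deterministic with respect to F₂.
  let 𝒞 : Finset V → Finset (Finset V) := fun U =>
    (fromEdgeSet ((F₁ \ G.edgesTouching U : Finset (Sym2 V)) : Set (Sym2 V))).bigClusters K
  have hr0 : 0 ≤ 1 - q ^ (2 * N) := by linarith [pow_le_one₀ (n := 2 * N) hq0 hq1]
  have hM := pow_nonneg hr0 m
  have hstep : bernProb q G.edgeFinset (fun F₂ => ¬ (fromEdgeSet ((F₁ ∪ F₂ : Finset (Sym2 V)) :
        Set (Sym2 V))).HasPathOfLengthAtLeast L) ≤
      ∑ U ∈ Us, ∑ σ ∈ (𝒞 U).powerset, (1 - q ^ (2 * N)) ^ m := by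
    refine (bernProb_mono hq0 hq1 (Q' := fun F₂ => ∃ U ∈ Us, ∃ σ ∈ (𝒞 U).powerset,
      α * Fintype.card V ≤ (σ.biUnion id).card ∧
      α * Fintype.card V ≤ ((𝒞 U \ σ).biUnion id).card ∧
      ¬ Joins (F₂ \ G.edgesTouching U) (σ.biUnion id) ((𝒞 U \ σ).biUnion id)) ?_).trans ?_
    · intro F₂ hF₂ hno
      obtain ⟨U, hU, σ, hσ, h1, h2, h3⟩ := exists_not_joins hG hF₁ hF₂
        (length_le_of_not_hasPath hL hno) hj
      refine ⟨U, by simpa [hUs] using hU, σ, Finset.mem_powerset.2 hσ, ?_, ?_, h3⟩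
      · have : (j : ℝ) ≤ (σ.biUnion id).card + 2 * K * (d * ℓ) := by exact_mod_cast h1
        linarith
      · have : (Fintype.card V : ℝ) ≤ ((𝒞 U \ σ).biUnion id).card + j +
            ((fromEdgeSet (F₁ : Set (Sym2 V))).smallVerts K).card + 2 * K * (d * ℓ) := by
          exact_mod_cast h2
        linarith
    · refine (bernProb_exists_le hq0 hq1 _ _).trans (Finset.sum_le_sum fun U hU => ?_)
      refine (bernProb_exists_le hq0 hq1 _ _).trans (Finset.sum_le_sum fun σ _ => ?_)
      by_cases hAB : α * Fintype.card V ≤ (σ.biUnion id).card ∧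
          α * Fintype.card V ≤ ((𝒞 U \ σ).biUnion id).card
      · refine (bernProb_mono hq0 hq1 fun F _ h => h.2.2).trans
          (bernProb_not_joins_le hG hexp hd hb hV hAB.1 hAB.2 _ hN m ?_ hq0 hq1)
        have h1 : ((G.edgesTouching U).card : ℝ) ≤ d * ℓ := by
          exact_mod_cast (hG.card_edgesTouching_le U).trans
            (Nat.mul_le_mul_left d (Finset.mem_filter.1 hU).2)
        linarith
      · refine le_trans (le_of_eq ?_) hM
        rw [bernProb, bernExp_congr (g := fun _ => 0), bernExp_const]
        intro F _
        rw [if_neg]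
        exact fun h => hAB ⟨h.1, h.2.1⟩
  refine hstep.trans ?_
  have hpow : ∀ U, (2 : ℝ) ^ (𝒞 U).card ≤ Real.exp (Fintype.card V / K) := by
    intro U
    have h1 : (2 : ℝ) ≤ Real.exp 1 := by linarith [Real.add_one_le_exp (1 : ℝ)]
    have h2 : ((𝒞 U).card : ℝ) * K ≤ Fintype.card V := by
      exact_mod_cast card_bigClusters_mul_le _ K
    refine (pow_le_pow_left₀ (by norm_num) h1 _).trans ?_
    rw [← Real.exp_nat_mul, mul_one, Real.exp_le_exp, le_div_iff₀ (by exact_mod_cast hK)]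
    exact h2
  calc ∑ U ∈ Us, ∑ σ ∈ (𝒞 U).powerset, (1 - q ^ (2 * N)) ^ m
      = ∑ U ∈ Us, (2 : ℝ) ^ (𝒞 U).card * (1 - q ^ (2 * N)) ^ m := by
        refine Finset.sum_congr rfl fun U _ => ?_
        rw [Finset.sum_const, Finset.card_powerset, nsmul_eq_mul]
        push_cast; rfl
    _ ≤ ∑ U ∈ Us, Real.exp (Fintype.card V / K) * (1 - q ^ (2 * N)) ^ m :=
        Finset.sum_le_sum fun U _ => mul_le_mul_of_nonneg_right (hpow U) hM
    _ = Us.card * Real.exp (Fintype.card V / K) * (1 - q ^ (2 * N)) ^ m := by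
        rw [Finset.sum_const, nsmul_eq_mul, mul_assoc]
    _ ≤ Real.exp (y * ℓ + Real.exp (-y) * Fintype.card V) * Real.exp (Fintype.card V / K) *
          (1 - q ^ (2 * N)) ^ m := by
        gcongr
        exact card_filter_card_le_exp ℓ hy
    _ = _ := by rw [← Real.exp_add]

/-- Otherwise a component would be a finite d-regular tree, so that d|T| = 2(|T| - 1), which is
impossible for d ≥ 2. This lets a large R exclude all small n. -/
lemma lt_card_of_lt_egirth [Nonempty V] (hG : G.IsRegularOfDegree d) (hd : 2 ≤ d) {R : ℕ}
    (hR : (R : ℕ∞) < G.egirth) : R < Fintype.card V := by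
  by_contra! hle
  obtain ⟨v⟩ := ‹Nonempty V›
  set T := (fromEdgeSet (G.edgeFinset : Set (Sym2 V))).cluster v with hT
  have hTR : (T.card : ℕ∞) < G.egirth :=
    lt_of_le_of_lt (by exact_mod_cast (Finset.card_le_univ T).trans hle) hR
  obtain ⟨htree, hiff⟩ := cluster_eq_iff_inter_eq (Finset.Subset.refl G.edgeFinset)
    (Finset.Subset.refl G.edgeFinset) (v := v) rfl hTR
  have h1 := hiff.1 rfl
  rw [Finset.inter_eq_right.2 (Finset.filter_subset _ _)] at h1
  have h2 := hG.card_touching_add T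
  have h3 := htree.card_edgeFinset_inter_sym2
  rw [← hT] at h1 h3
  rw [h1] at h2
  nlinarith

end BigClusters

end SimpleGraph

/-! ### Numerical estimates and two-round exposure -/

lemma supercritical_ratio_lt_one {p₀ p : ℝ} (h0 : 0 < p₀) (h : p₀ < p) (h1 : p < 1) :
    p₀ * (1 - p) ^ 2 / (p * (1 - p₀) ^ 2) < 1 := by
  have hp : 0 < p := h0.trans h
  have h2 : 0 < 1 - p₀ := by linarith
  rw [div_lt_one (by positivity)]
  have h3 : (1 - p) ^ 2 < (1 - p₀) ^ 2 := pow_lt_pow_left₀ (by linarith) (by linarith) two_ne_zero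
  exact mul_lt_mul h h3.le (pow_pos (by linarith) 2) hp.le

lemma one_sub_pow_floor_le_exp {r lam η : ℝ} (hr : 0 < r) (hlam : lam = -Real.log r)
    (hlam0 : 0 ≤ lam) (n : ℕ) :
    r ^ ⌊η * n⌋₊ ≤ Real.exp (lam - lam * η * n) := by
  have h1 : r = Real.exp (-lam) := by rw [hlam, neg_neg, Real.exp_log hr]
  rw [h1, ← Real.exp_nat_mul, Real.exp_le_exp]
  nlinarith [Nat.lt_floor_add_one (η * n)]

lemma exp_add_exp_le {lam c₁ c₂ c₀ n : ℝ} (hlam : 0 ≤ lam) (hn : 0 ≤ n) (h₁ : c₀ ≤ c₁)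
    (h₂ : c₀ ≤ c₂) (h : lam + 1 ≤ c₀ / 2 * n) :
    Real.exp (-c₁ * n) + Real.exp (lam - c₂ * n) ≤ Real.exp (-(c₀ / 2) * n) := by
  have e1 : Real.exp (-c₁ * n) ≤ Real.exp lam * Real.exp (-c₀ * n) := by
    rw [← Real.exp_add, Real.exp_le_exp]; nlinarith
  have e2 : Real.exp (lam - c₂ * n) ≤ Real.exp lam * Real.exp (-c₀ * n) := by
    rw [← Real.exp_add, Real.exp_le_exp]; nlinarith
  have e3 : (2 : ℝ) ≤ Real.exp 1 := by linarith [Real.add_one_le_exp (1 : ℝ)]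
  calc _ ≤ 2 * (Real.exp lam * Real.exp (-c₀ * n)) := by linarith
    _ ≤ Real.exp 1 * (Real.exp lam * Real.exp (-c₀ * n)) := by gcongr
    _ = Real.exp (1 + (lam + -c₀ * n)) := by rw [Real.exp_add, Real.exp_add]
    _ ≤ _ := by rw [Real.exp_le_exp]; linarith

/-- Condition on the first round: a bad outcome costs at most 1, any other at most M. -/
lemma bernProb_le_of_sprinkle {α : Type*} [DecidableEq α] {E : Finset α} {p₁ q M : ℝ}
    (hp0 : 0 ≤ p₁) (hp1 : p₁ ≤ 1) (hq0 : 0 ≤ q) (hq1 : q ≤ 1) (hM : 0 ≤ M)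
    (Bad Q : Finset α → Prop)
    (h : ∀ S ⊆ E, ¬ Bad S → bernProb q E (fun T => Q (S ∪ T)) ≤ M) :
    bernProb (1 - (1 - p₁) * (1 - q)) E Q ≤ bernProb p₁ E Bad + M := by
  rw [bernProb, bernExp_sprinkle]
  refine le_of_le_of_eq (bernExp_mono hp0 hp1 (g := fun S => (open Classical in
    if Bad S then 1 else 0) + M) fun S hS => ?_) ?_
  · by_cases hB : Bad S
    · simp only [hB, if_true]
      linarith [bernProb_le_one (E := E) hq0 hq1 (fun T => Q (S ∪ T)), h, bernProb.eq_def q E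
        (fun T => Q (S ∪ T))]
    · simp only [hB, if_false]
      linarith [h S hS hB, bernProb.eq_def q E (fun T => Q (S ∪ T))]
  · rw [bernExp_add, bernExp_const]; rfl

/-! ### The final estimate -/

namespace SimpleGraph

/-- The final estimate, for parameters subject to explicit inequalities. -/
lemma bernProb_not_hasPath_le_exp {V : Type*} [Fintype V] [DecidableEq V] {G : SimpleGraph V}
    [DecidableRel G.Adj] {m K N : ℕ} {D b p₁ q ρ ε β η lam c₀ c₁ c₂ y t δ : ℝ}
    (hm : 0 < m) (hD : D = ((m + 2 : ℕ) : ℝ)) (hb : 0 < b) (hp₁pos : 0 < p₁) (hp₁lt : p₁ < 1)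
    (hq0 : 0 < q) (hq1 : q < 1)
    (hρ : ρ = 1 / (m + 1) * (1 - p₁) ^ 2 / (p₁ * (1 - 1 / (m + 1)) ^ 2)) (hε : ρ = 1 - 2 * ε)
    (hεpos : 0 < ε) (hN0 : 0 < N) (hN : 1 < N * (b * (ε / 4) / D)) (hr0 : 0 < 1 - q ^ (2 * N))
    (hlam : lam = -Real.log (1 - q ^ (2 * N))) (hlampos : 0 < lam)
    (hβ : β = b * (ε / 4) / 2) (hη : η = β / (4 * N)) (hηpos : 0 < η) (hc₂ : c₂ = lam * η)
    (hypos : 0 < y) (hyexp : Real.exp (-y) ≤ c₂ / 8) (hK0 : 0 < K) (hKc : 1 / (K : ℝ) ≤ c₂ / 4)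
    (hδpos : 0 < δ) (hδ1 : D * δ ≤ β / 2) (hδ2 : y * δ ≤ c₂ / 8)
    (hδ3 : 2 * K * (D * δ) ≤ ε / 8) (ht : t = ε / (8 * K ^ 2 * D)) (htpos : 0 < t)
    (htK : t * (2 * K) ≤ 1) (hc₁ : c₁ = t * ε / 2) (hc₀₁ : c₀ ≤ c₁) (hc₀₂ : c₀ ≤ c₂ / 2)
    (hG : G.IsRegularOfDegree (m + 2)) (hexp : G.IsExpander b (m + 2))
    (hKgirth : (K : ℕ∞) < G.egirth) {n : ℕ} (hn : n = Fintype.card V) (hn0 : (0 : ℝ) < n)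
    (hn1 : 8 ≤ ε * n) (hn2 : 2 ≤ δ * n) (hn3 : lam + 1 ≤ c₀ / 2 * n) :
    bernProb (1 - (1 - p₁) * (1 - q)) G.edgeFinset (fun S => ¬
      (fromEdgeSet (S : Set (Sym2 V))).HasPathOfLengthAtLeast (δ / 2 * (n : ℝ))) ≤
        Real.exp (-(c₀ / 2) * n) := by
  have hV : 0 < Fintype.card V := by rw [← hn]; exact_mod_cast hn0
  have hDpos : 0 < D := by rw [hD]; positivity
  have hKR : (0 : ℝ) < K := by exact_mod_cast hK0
  have hNR : (0 : ℝ) < N := by exact_mod_cast hN0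
  have hsmall := bernProb_card_smallVerts_ge hp₁pos.le hp₁lt.le (a := ε * n)
    G.edgeFinset htpos.le htK (fun v =>
      bernProb_card_cluster_lt hm hG hKgirth v hp₁pos hp₁lt.le)
  rw [← hρ, ← hn] at hsmall
  have hsmall' : Real.exp (t ^ 2 * (2 * K) ^ 2 * G.edgeFinset.card - t * (ε * n)) ≤
      Real.exp (-c₁ * n) := by
    have hcard : (G.edgeFinset.card : ℝ) ≤ D * n := by
      have h1 := G.sum_degrees_eq_twice_card_edges
      rw [Finset.sum_congr rfl fun v _ => hG v, Finset.sum_const, Finset.card_univ, smul_eq_mul,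
        ← hn] at h1
      have h2 : (n : ℝ) * D = 2 * G.edgeFinset.card := by rw [hD]; exact_mod_cast h1
      have : (0 : ℝ) ≤ G.edgeFinset.card := Nat.cast_nonneg _
      linarith
    rw [Real.exp_le_exp]
    have h1 : t ^ 2 * (2 * K) ^ 2 * G.edgeFinset.card ≤ t ^ 2 * (2 * K) ^ 2 * (D * n) := by gcongr
    -- The value of t minimizes 4K²Dt² - εt, where the quadratic term is half of the linear one.
    have h2 : t ^ 2 * (2 * K) ^ 2 * (D * n) = c₁ * n := by
      rw [hc₁, ht]; field_simp; ring
    have h3 : t * (ε * n) = 2 * (c₁ * n) := by rw [hc₁]; ring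
    linarith
  have hsum := exp_add_exp_le hlampos.le hn0.le hc₀₁ hc₀₂ hn3
  suffices hspr : bernProb (1 - (1 - p₁) * (1 - q)) G.edgeFinset (fun S => ¬
      (fromEdgeSet (S : Set (Sym2 V))).HasPathOfLengthAtLeast (δ / 2 * (n : ℝ))) ≤
        bernProb p₁ G.edgeFinset (fun F => ρ * n + ε * n ≤
          (((fromEdgeSet (F : Set (Sym2 V))).smallVerts K).card : ℝ)) +
            Real.exp (lam - c₂ / 2 * n) from
    hspr.trans ((add_le_add (hsmall.trans hsmall') le_rfl).trans hsum)
  refine bernProb_le_of_sprinkle hp₁pos.le hp₁lt.le hq0.le hq1.le (Real.exp_pos _).le _ _ ?_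
  intro F₁ hF₁ hgood
  rw [not_le] at hgood
  set s := ((fromEdgeSet (F₁ : Set (Sym2 V))).smallVerts K).card with hs
  have hgood' : (s : ℝ) ≤ n - ε * n := by
    rw [hε] at hgood
    linarith
  set ℓ := ⌊δ * n⌋₊ with hℓ
  have hℓle : (ℓ : ℝ) ≤ δ * n := Nat.floor_le (by positivity)
  have hℓge : δ / 2 * n ≤ ℓ := by
    have := Nat.lt_floor_add_one (δ * n)
    rw [← hℓ] at this
    linarith
  -- Half of the guaranteed εn vertices. Rounding (as εn ≥ 8) and the deletion at U cost at most
  -- εn/8 each, so εn/4 remain on either side.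
  set j := ⌊ε * n / 2⌋₊ with hj
  have hjle : (j : ℝ) ≤ ε * n / 2 := Nat.floor_le (by positivity)
  have hjge : ε * n / 2 - 1 < j := by
    have := Nat.lt_floor_add_one (ε * n / 2)
    rw [← hj] at this
    linarith
  have hKℓ : 2 * K * (D * ℓ) ≤ ε / 8 * n :=
    calc 2 * K * (D * ℓ) ≤ 2 * K * (D * (δ * n)) := by gcongr
      _ = 2 * K * (D * δ) * n := by ring
      _ ≤ ε / 8 * n := by gcongr
  have hηn : (⌊η * n⌋₊ : ℝ) * (2 * N) ≤ β / 2 * n :=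
    calc (⌊η * n⌋₊ : ℝ) * (2 * N) ≤ η * n * (2 * N) := by
          gcongr; exact Nat.floor_le (by positivity)
      _ = β / 2 * n := by rw [hη]; field_simp; ring
  have hDℓ : D * ℓ ≤ β / 2 * n :=
    calc D * ℓ ≤ D * (δ * n) := by gcongr
      _ = D * δ * n := by ring
      _ ≤ β / 2 * n := by gcongr
  refine (bernProb_not_hasPath_le hG hexp (by omega) hb hV hF₁ (α := ε / 4) (j := j)
    (m := ⌊η * n⌋₊) hℓge hK0 hypos.le hq0.le hq1.le (hD ▸ hN) ?_ ?_ ?_ ?_).trans ?_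
  · rw [← hD, ← hn, ← hβ]
    linarith
  · have : (j : ℝ) + s ≤ n := by linarith
    rw [← hs, ← hn]
    exact_mod_cast this
  · rw [← hD, ← hn]
    linarith
  · rw [← hD, ← hn, ← hs]
    linarith
  · rw [← hn]
    refine (mul_le_mul_of_nonneg_left (one_sub_pow_floor_le_exp hr0 hlam hlampos.le n)
      (Real.exp_pos _).le).trans ?_
    rw [← Real.exp_add, Real.exp_le_exp]
    have h1 : y * ℓ ≤ c₂ / 8 * n :=
      calc y * ℓ ≤ y * (δ * n) := by gcongr
        _ = y * δ * n := by ring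
        _ ≤ _ := by gcongr
    have h2 : Real.exp (-y) * n ≤ c₂ / 8 * n := by gcongr
    have h3 : (n : ℝ) / K ≤ c₂ / 4 * n := by
      rw [div_eq_mul_one_div, mul_comm]; gcongr
    have h4 : lam * η * n = c₂ * n := by rw [hc₂]
    -- The entropy terms total c₂(1/8 + 1/8 + 1/4) = c₂/2, half of the available exponent.
    linarith

end SimpleGraph

/-! ### The choice of constants -/

theorem corollary4p2 (d : ℕ) (hd : 3 ≤ d) (p : unitInterval)
    (hp : 1 / ((d : ℝ) - 1) < (p : ℝ)) (hp1 : (p : ℝ) < 1) (b : ℝ) (hb : 0 < b) :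
    ∃ (δ c : ℝ) (R : ℕ), 0 < δ ∧ 0 < c ∧ 0 < R ∧
      ∀ (V : Type*) [Fintype V] [DecidableEq V] (G : SimpleGraph V) [DecidableRel G.Adj],
        G.IsRegularOfDegree d → G.IsExpander b d → (R : ℕ∞) < G.egirth →
          1 - Real.exp (-c * (Fintype.card V : ℝ)) ≤
            (G.bondPercolation p).real
              {H : SimpleGraph V | H.HasPathOfLengthAtLeast (δ * (Fintype.card V : ℝ))} := by
  obtain ⟨m, rfl⟩ : ∃ m, d = m + 2 := ⟨d - 2, by omega⟩
  have hm : 0 < m := by omega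
  have hmR : (0 : ℝ) < m := by exact_mod_cast hm
  obtain ⟨D, hD⟩ : ∃ x : ℝ, x = ((m + 2 : ℕ) : ℝ) := ⟨_, rfl⟩
  have hDpos : 0 < D := by rw [hD]; positivity
  obtain ⟨p₀, hp₀⟩ : ∃ x : ℝ, x = 1 / (m + 1) := ⟨_, rfl⟩
  have hp' : p₀ < (p : ℝ) := by
    refine lt_of_eq_of_lt ?_ hp
    rw [hp₀]; push_cast; ring
  have hp₀pos : 0 < p₀ := by rw [hp₀]; positivity
  obtain ⟨p₁, hp₁l, hp₁r⟩ := exists_between hp'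
  have hp₁pos : 0 < p₁ := hp₀pos.trans hp₁l
  have hp₁lt : p₁ < 1 := hp₁r.trans hp1
  obtain ⟨q, hq⟩ : ∃ x : ℝ, x = (p - p₁) / (1 - p₁) := ⟨_, rfl⟩
  have hq0 : 0 < q := hq ▸ div_pos (by linarith) (by linarith)
  have hq1 : q < 1 := by rw [hq, div_lt_one (by linarith)]; linarith
  have hpq : (p : ℝ) = 1 - (1 - p₁) * (1 - q) := by
    have : (1 : ℝ) - p₁ ≠ 0 := by linarith
    rw [hq]; field_simp; ring
  obtain ⟨ρ, hρ⟩ : ∃ x : ℝ, x = p₀ * (1 - p₁) ^ 2 / (p₁ * (1 - p₀) ^ 2) := ⟨_, rfl⟩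
  have hρ1 : ρ < 1 := hρ ▸ supercritical_ratio_lt_one hp₀pos hp₁l hp₁lt
  obtain ⟨ε, hε⟩ : ∃ x : ℝ, x = (1 - ρ) / 2 := ⟨_, rfl⟩
  have hερ : ρ = 1 - 2 * ε := by rw [hε]; ring
  have hεpos : 0 < ε := by linarith
  have hε1 : ε ≤ 1 := by
    have : 0 ≤ ρ := by rw [hρ]; positivity
    linarith
  obtain ⟨N, hN⟩ := exists_nat_gt (1 / (b * (ε / 4) / D))
  rw [div_lt_iff₀ (by positivity)] at hN
  have hN0 : 0 < N := by
    rcases Nat.eq_zero_or_pos N with rfl | h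
    · simp at hN; linarith
    · exact h
  have hNR : (0 : ℝ) < N := by exact_mod_cast hN0
  have hr0 : 0 < 1 - q ^ (2 * N) := by
    have := pow_lt_one₀ hq0.le hq1 (by omega : 2 * N ≠ 0)
    linarith
  have hr1 : 1 - q ^ (2 * N) < 1 := by
    have := pow_pos hq0 (2 * N)
    linarith
  obtain ⟨lam, hlam⟩ : ∃ x : ℝ, x = -Real.log (1 - q ^ (2 * N)) := ⟨_, rfl⟩
  have hlampos : 0 < lam := by
    have := Real.log_neg hr0 hr1
    linarith
  obtain ⟨β, hβ⟩ : ∃ x : ℝ, x = b * (ε / 4) / 2 := ⟨_, rfl⟩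
  have hβpos : 0 < β := by rw [hβ]; positivity
  obtain ⟨η, hη⟩ : ∃ x : ℝ, x = β / (4 * N) := ⟨_, rfl⟩
  have hηpos : 0 < η := by rw [hη]; positivity
  obtain ⟨c₂, hc₂⟩ : ∃ x : ℝ, x = lam * η := ⟨_, rfl⟩
  have hc₂pos : 0 < c₂ := by rw [hc₂]; positivity
  obtain ⟨y, hy⟩ : ∃ x : ℝ, x = Real.log (1 + 8 / c₂) := ⟨_, rfl⟩
  have hypos : 0 < y := by
    have : 0 < 8 / c₂ := by positivity
    rw [hy]
    exact Real.log_pos (by linarith)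
  have hyexp : Real.exp (-y) ≤ c₂ / 8 := by
    rw [Real.exp_neg, hy, Real.exp_log (by positivity), inv_le_comm₀ (by positivity)
      (by positivity), inv_div]
    linarith
  -- No circularity: ρ, hence ε, N and c₂, were fixed without reference to K.
  obtain ⟨K, hK⟩ := exists_nat_gt (4 / c₂)
  have hKR : (0 : ℝ) < K := lt_trans (by positivity) hK
  have hK0 : 0 < K := by exact_mod_cast hKR
  have hKc : 1 / (K : ℝ) ≤ c₂ / 4 := by
    rw [div_lt_iff₀ hc₂pos] at hK
    rw [div_le_iff₀ hKR]; linarith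
  -- The three bounds control the number of edges deleted at U, the number of choices of U, and the
  -- vertices lost from big clusters.
  obtain ⟨δ, hδ⟩ : ∃ x : ℝ,
      x = min (β / (2 * D)) (min (c₂ / (8 * y)) (ε / (16 * K * D))) := ⟨_, rfl⟩
  have hδpos : 0 < δ := by
    rw [hδ]
    exact lt_min (by positivity) (lt_min (by positivity) (by positivity))
  have hδ1 : D * δ ≤ β / 2 := by
    have : δ ≤ β / (2 * D) := hδ.le.trans <| min_le_left _ _
    rw [le_div_iff₀ (by positivity)] at this
    linarith only [this]
  have hδ2 : y * δ ≤ c₂ / 8 := by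
    have : δ ≤ c₂ / (8 * y) := hδ.le.trans <| (min_le_right _ _).trans (min_le_left _ _)
    rw [le_div_iff₀ (by positivity)] at this
    linarith only [this]
  have hδ3 : 2 * K * (D * δ) ≤ ε / 8 := by
    have : δ ≤ ε / (16 * K * D) := hδ.le.trans <| (min_le_right _ _).trans (min_le_right _ _)
    rw [le_div_iff₀ (by positivity)] at this
    linarith only [this]
  obtain ⟨t, ht⟩ : ∃ x : ℝ, x = ε / (8 * K ^ 2 * D) := ⟨_, rfl⟩
  have htpos : 0 < t := by rw [ht]; positivity
  have htK : t * (2 * K) ≤ 1 := by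
    rw [ht, div_mul_eq_mul_div, div_le_one (by positivity)]
    have h1 : (1 : ℝ) ≤ K := by exact_mod_cast hK0
    have h2 : (1 : ℝ) ≤ D := by rw [hD]; push_cast; linarith only [hmR]
    have h3 : (K : ℝ) ≤ K ^ 2 * D := by
      rw [pow_two, mul_assoc]
      exact le_mul_of_one_le_right hKR.le (one_le_mul_of_one_le_of_one_le h1 h2)
    have h4 : ε * K ≤ 1 * K := mul_le_mul_of_nonneg_right hε1 hKR.le
    linarith only [h3, h4, hKR]
  obtain ⟨c₁, hc₁⟩ : ∃ x : ℝ, x = t * ε / 2 := ⟨_, rfl⟩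
  have hc₁pos : 0 < c₁ := by rw [hc₁]; positivity
  obtain ⟨c₀, hc₀⟩ : ∃ x : ℝ, x = min c₁ (c₂ / 2) := ⟨_, rfl⟩
  have hc₀pos : 0 < c₀ := hc₀ ▸ lt_min hc₁pos (by positivity)
  obtain ⟨R₁, hR₁⟩ := exists_nat_ge (8 / ε)
  obtain ⟨R₂, hR₂⟩ := exists_nat_ge (2 / δ)
  obtain ⟨R₃, hR₃⟩ := exists_nat_ge ((lam + 1) / (c₀ / 2))
  -- Half of δ leaves room for rounding δn down. R exceeds K, for the tree structure of small
  -- clusters, and forces n to be large.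
  refine ⟨δ / 2, c₀ / 2, K + R₁ + R₂ + R₃, by positivity, by positivity, by omega, ?_⟩
  intro V _ _ G _ hG hexp hgirth
  have hne : Nonempty V := by
    by_contra h
    rw [not_nonempty_iff] at h
    have := hexp.1
    simp at this
  have hV : 0 < Fintype.card V := Fintype.card_pos
  have hRn := SimpleGraph.lt_card_of_lt_egirth hG (by omega) hgirth
  have hKgirth : (K : ℕ∞) < G.egirth := lt_of_le_of_lt (by exact_mod_cast (by omega)) hgirth
  obtain ⟨n, hn⟩ : ∃ n, n = Fintype.card V := ⟨_, rfl⟩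
  rw [← hn] at hRn hV ⊢
  have hn0 : (0 : ℝ) < n := by exact_mod_cast hV
  have hn1 : 8 ≤ ε * n := by
    have : (R₁ : ℝ) ≤ n := by exact_mod_cast (by omega)
    rw [div_le_iff₀ hεpos] at hR₁
    exact hR₁.trans ((mul_le_mul_of_nonneg_right this hεpos.le).trans_eq (mul_comm _ _))
  have hn2 : 2 ≤ δ * n := by
    have : (R₂ : ℝ) ≤ n := by exact_mod_cast (by omega)
    rw [div_le_iff₀ hδpos] at hR₂
    exact hR₂.trans ((mul_le_mul_of_nonneg_right this hδpos.le).trans_eq (mul_comm _ _))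
  have hn3 : lam + 1 ≤ c₀ / 2 * n := by
    have : (R₃ : ℝ) ≤ n := by exact_mod_cast (by omega)
    rw [div_le_iff₀ (by positivity)] at hR₃
    exact hR₃.trans ((mul_le_mul_of_nonneg_right this (by positivity)).trans_eq (mul_comm _ _))
  rw [SimpleGraph.bondPercolation_real]
  have hcompl := bernProb_compl (p := (p : ℝ)) (E := G.edgeFinset) (fun S =>
    (SimpleGraph.fromEdgeSet (S : Set (Sym2 V))).HasPathOfLengthAtLeast (δ / 2 * (n : ℝ)))
  suffices hmain : bernProb (p : ℝ) G.edgeFinset (fun S => ¬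
      (SimpleGraph.fromEdgeSet (S : Set (Sym2 V))).HasPathOfLengthAtLeast (δ / 2 * (n : ℝ))) ≤
        Real.exp (-(c₀ / 2) * n) by linarith only [hcompl, hmain]
  rw [hpq]
  exact SimpleGraph.bernProb_not_hasPath_le_exp hm hD hb hp₁pos hp₁lt hq0 hq1 (hp₀ ▸ hρ) hερ hεpos hN0 hN
    hr0 hlam hlampos hβ hη hηpos hc₂ hypos hyexp hK0 hKc hδpos hδ1 hδ2 hδ3 ht htpos htK hc₁
    (hc₀.le.trans (min_le_left _ _)) (hc₀.le.trans (min_le_right _ _)) hG hexp hKgirth hn hn0 hn1 hn2 hn3
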